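/- Let $\mathbb K$ be an algebraically closed field of arbitrary characteristic and let $X\subset\mathbb P^r$ be an integral, non-degenerate projective variety of dimension $n$ over $\mathbb K$. For $q\in\mathbb P^r$, the $X$-rank $r_X(q)$ is the least cardinality of a finite set $A\subset X$ whose linear span $\langle A\rangle$ contains $q$, and $\mathcal S(q)$ denotes the set of minimal decompositions of $q$, i.e. of all $A\subset X$ with $\sharp(A)=r_X(q)$ and $q\in\langle A\rangle$. For $k\ge 1$ let $\sigma_k(X)\subseteq\mathbb P^r$ be the $k$-th secant variety of $X$, i.e. the Zariski closure of the union of the linear spans of all sets of at most $k$ points of $X$, and let the $k$-th secant degree $\alpha_k$ be the cardinality of $\mathcal S(q)$ for a general $q\in\sigma_k(X)$. Assume that $\dim\sigma_{k+1}(X)=(k+1)(n+1)-1$ and $\alpha_k>1$. Then for a general $q\in\sigma_{k+1}(X)$ (that is, for all $q$ in a nonempty Zariski open subset of $\sigma_{k+1}(X)$) the following holds: for every $A\in\mathcal S(q)$ and every $a\in A$ there are at least $\alpha_k$ distinct elements $B_1,\ldots,B_{\alpha_k}\in\mathcal S(q)$, one of them being $A$, such that $a\in B_i$ for all $i=1,\ldots,\alpha_k$.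 -/

import Mathlib

open scoped LinearAlgebra.Projectivization

/-- `ℙ^r` over `K`: the lines through the origin of `K^{r+1}`. -/
abbrev PSpace (K : Type*) [Field K] (r : ℕ) := ℙ K (Fin (r + 1) → K)

namespace PSpace

variable {K : Type*} [Field K] {r : ℕ}

/-- The common zeros in `ℙ^r` of a set of polynomials. It is used for homogeneous polynomials only,
whose vanishing at `p` does not depend on the representative `p.rep`. -/
def zeros (S : Set (MvPolynomial (Fin (r + 1)) K)) : Set (PSpace K r) :=
  {p | ∀ f ∈ S, MvPolynomial.eval p.rep f = 0}

/-- An algebraic subset of `ℙ^r`: the zero set of a family of homogeneous polynomials. -/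
def IsAlgebraic (Z : Set (PSpace K r)) : Prop :=
  ∃ S : Set (MvPolynomial (Fin (r + 1)) K),
    (∀ f ∈ S, ∃ d : ℕ, f.IsHomogeneous d) ∧ Z = zeros S

theorem isAlgebraic_empty : IsAlgebraic (∅ : Set (PSpace K r)) := by
  refine ⟨{1}, ?_, ?_⟩
  · rintro f rfl
    exact ⟨0, MvPolynomial.isHomogeneous_one _ _⟩
  · ext p
    simp [zeros]

theorem isAlgebraic_sInter (A : Set (Set (PSpace K r))) (hA : ∀ Z ∈ A, IsAlgebraic Z) :
    IsAlgebraic (⋂₀ A) := by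
  refine ⟨{f | (∃ d : ℕ, f.IsHomogeneous d) ∧
    ∃ Z ∈ A, ∀ p ∈ Z, MvPolynomial.eval p.rep f = 0}, fun f hf => hf.1, ?_⟩
  ext p
  constructor
  · rintro hp f ⟨-, Z, hZ, hf⟩
    exact hf p (hp Z hZ)
  · intro hp Z hZ
    obtain ⟨S, hS, rfl⟩ := hA Z hZ
    intro f hf
    exact hp f ⟨hS f hf, zeros S, hZ, fun q hq => hq f hf⟩

theorem isAlgebraic_union (Y Z : Set (PSpace K r)) (hY : IsAlgebraic Y) (hZ : IsAlgebraic Z) :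
    IsAlgebraic (Y ∪ Z) := by
  obtain ⟨S, hS, rfl⟩ := hY
  obtain ⟨T, hT, rfl⟩ := hZ
  refine ⟨{h | ∃ f ∈ S, ∃ g ∈ T, h = f * g}, ?_, ?_⟩
  · rintro h ⟨f, hf, g, hg, rfl⟩
    obtain ⟨d, hd⟩ := hS f hf
    obtain ⟨e, he⟩ := hT g hg
    exact ⟨d + e, hd.mul he⟩
  · ext p
    constructor
    · rintro (hp | hp) h ⟨f, hf, g, hg, rfl⟩
      · simp [hp f hf]
      · simp [hp g hg]
    · intro hp
      by_contra hcon
      simp only [Set.mem_union, not_or, zeros, Set.mem_ofPred_eq, not_forall] at hcon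
      obtain ⟨⟨f, hf, hf0⟩, g, hg, hg0⟩ := hcon
      have := hp (f * g) ⟨f, hf, g, hg, rfl⟩
      rw [map_mul] at this
      exact (mul_ne_zero hf0 hg0) this

/-- The Zariski topology on `ℙ^r`: the closed sets are the algebraic subsets. -/
instance zariskiTopology : TopologicalSpace (PSpace K r) :=
  TopologicalSpace.ofClosed {Z | IsAlgebraic Z} isAlgebraic_empty isAlgebraic_sInter
    (fun Y hY Z hZ => isAlgebraic_union Y Z hY hZ)

/-- `P q` holds for a general point `q` of the (irreducible) variety `Y`: it holds at all points
of some nonempty Zariski open subset of `Y`. -/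
def ForGeneral (Y : Set (PSpace K r)) (P : PSpace K r → Prop) : Prop :=
  ∃ U : Set (PSpace K r), IsOpen U ∧ (Y ∩ U).Nonempty ∧ ∀ q ∈ Y ∩ U, P q

/-- The dimension of a subset of `ℙ^r`: the Krull dimension of its induced Zariski topology. -/
noncomputable def dim (Y : Set (PSpace K r)) : WithBot ℕ∞ := topologicalKrullDim Y

/-- The `k`-th secant variety `σ_k(X)`: the closure of the union of the linear spans of all
sets of at most `k` points of `X`. -/
def secantVariety (k : ℕ) (X : Set (PSpace K r)) : Set (PSpace K r) :=
  closure {q | ∃ A : Finset (PSpace K r), (A : Set (PSpace K r)) ⊆ X ∧ A.card ≤ k ∧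
    q ∈ Projectivization.Subspace.span (A : Set (PSpace K r))}

/-- The `X`-rank of `q`: the least cardinality of a finite subset of `X` whose span contains `q`.
(If `X` spans `ℙ^r`, such finite subsets exist for all `q`.) -/
noncomputable def xRank (X : Set (PSpace K r)) (q : PSpace K r) : ℕ :=
  sInf {m | ∃ A : Finset (PSpace K r), (A : Set (PSpace K r)) ⊆ X ∧ A.card = m ∧
    q ∈ Projectivization.Subspace.span (A : Set (PSpace K r))}

/-- `𝒮_X(q)`: the set of minimal `X`-decompositions of `q`, that is, of the finite subsets of `X`
of cardinality the `X`-rank of `q` whose span contains `q`. -/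
def minDecomps (X : Set (PSpace K r)) (q : PSpace K r) : Set (Finset (PSpace K r)) :=
  {A | (A : Set (PSpace K r)) ⊆ X ∧ A.card = xRank X q ∧
    q ∈ Projectivization.Subspace.span (A : Set (PSpace K r))}

open Classical in
/-- The `k`-th secant degree `α_k` of `X`: the number of minimal `X`-decompositions of a general
point of `σ_k(X)`. (When `X` is irreducible there is at most one such generic number; the value is
`0` by convention if there is none.) -/
noncomputable def secantDegree (k : ℕ) (X : Set (PSpace K r)) : ℕ∞ :=
  if h : ∃ m : ℕ∞, ForGeneral (secantVariety k X) (fun q => (minDecomps X q).encard = m)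
  then h.choose else 0

theorem secantDegree_eq {k : ℕ} {X : Set (PSpace K r)} (hσ : IsIrreducible (secantVariety k X))
    {m : ℕ∞} (hm : ForGeneral (secantVariety k X) (fun q => (minDecomps X q).encard = m)) :
    secantDegree k X = m := by
  have h : ∃ m : ℕ∞, ForGeneral (secantVariety k X) (fun q => (minDecomps X q).encard = m) :=
    ⟨m, hm⟩
  obtain ⟨V, hV, hVne, hVm⟩ := h.choose_spec
  obtain ⟨U, hU, hUne, hUm⟩ := hm
  obtain ⟨q, hq, hqU, hqV⟩ := hσ.2 U V hU hV hUne hVne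
  rw [secantDegree, dif_pos h, ← hVm q ⟨hq, hqV⟩, hUm q ⟨hq, hqU⟩]

end PSpace

/-! Let `q` be general in σ_{k+1} and let `a ∈ A` with `A` a minimal decomposition. Split a
representative of `q` as `c • a + v` with `v` in the span of `A \ {a}`; the point `q'` of `v` lies
in σ_k. If `q'` lies in the open set `U` on which the number of minimal decompositions is α_k, then
`B ↦ B ∪ {a}` injects the minimal decompositions of `q'` into those of `q`, and `A` is in the image
(`exists_decomps_of_general`).

The `q` for which `q'` is bad lie in the join of `X` with `Z = σ_k \ U`. So it is enough that
σ_{k+1} is contained neither in the closure of this join nor in σ_k, and that its general point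
really lies on a span of `k + 1` points; the last is Chevalley's theorem
(`exists_isOpen_rep_mem_nsmul_cone`).

Dimension is measured by the exponent `s` in a bound `C * (d + 1) ^ s` for the Hilbert function of
an affine cone. Exponents add under sums of cones (`HasGrowth.add`), drop by one on proper closed
subsets of irreducible sets (`HasGrowth.drop`), and for a closed set of Krull dimension D the
exponent D + 1 works and nothing smaller does (`hasGrowth_cone`, `succ_le_of_hasGrowth`). So `Z` has
exponent k(n+1) - 1 and the join (k+1)(n+1) - 1, one less than σ_{k+1} requires. -/

open MvPolynomial Module
open scoped Pointwise

/-! ### Affine Hilbert functions and their growth -/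

section Affine

variable {K σ : Type*} [Field K]

/-- The linear map sending a polynomial to the function that it defines on `S`. -/
noncomputable def evalOn (S : Set (σ → K)) : MvPolynomial σ K →ₗ[K] (S → K) :=
  LinearMap.pi fun s => (aeval s.1).toLinearMap

@[simp]
theorem evalOn_apply (S : Set (σ → K)) (p : MvPolynomial σ K) (s : S) :
    evalOn S p s = eval s.1 p := by
  simp [evalOn, aeval_eq_eval]

theorem evalOn_mul (S : Set (σ → K)) (p q : MvPolynomial σ K) :
    evalOn S (p * q) = evalOn S p * evalOn S q := by
  ext s; simp

/-- The space of functions on `S` defined by polynomials of degree at most `d`. -/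
noncomputable def polyFun (S : Set (σ → K)) (d : ℕ) : Submodule K (S → K) :=
  (restrictTotalDegree σ K d).map (evalOn S)

instance [Finite σ] (S : Set (σ → K)) (d : ℕ) : Module.Finite K (polyFun S d) :=
  inferInstanceAs (Module.Finite K ((restrictTotalDegree σ K d).map (evalOn S)))

/-- The affine Hilbert function of `S`. -/
noncomputable def hilb (S : Set (σ → K)) (d : ℕ) : ℕ := finrank K (polyFun S d)

/-- The Hilbert function of `S` grows at most like a polynomial of degree `s`. -/
def HasGrowth (S : Set (σ → K)) (s : ℕ) : Prop := ∃ C, ∀ d, hilb S d ≤ C * (d + 1) ^ s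

/-- The points at which all polynomials that vanish on `S` vanish. -/
def zclosure (S : Set (σ → K)) : Set (σ → K) :=
  {v | ∀ p : MvPolynomial σ K, (∀ s ∈ S, eval s p = 0) → eval v p = 0}

/-- `S` is nonempty and the polynomials vanishing on `S` form a prime ideal. -/
def PolyIrred (S : Set (σ → K)) : Prop :=
  S.Nonempty ∧ ∀ p q : MvPolynomial σ K, (∀ s ∈ S, eval s p * eval s q = 0) →
    (∀ s ∈ S, eval s p = 0) ∨ ∀ s ∈ S, eval s q = 0

theorem subset_zclosure (S : Set (σ → K)) : S ⊆ zclosure S := fun s hs _ hp => hp s hs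

theorem mem_polyFun {S : Set (σ → K)} {p : MvPolynomial σ K} {d : ℕ} (hp : p.totalDegree ≤ d) :
    evalOn S p ∈ polyFun S d :=
  Submodule.mem_map_of_mem ((mem_restrictTotalDegree σ d p).2 hp)

theorem polyFun_mono (S : Set (σ → K)) {d e : ℕ} (h : d ≤ e) : polyFun S d ≤ polyFun S e := by
  rintro _ ⟨p, hp, rfl⟩
  exact mem_polyFun (((mem_restrictTotalDegree σ d p).1 hp).trans h)

theorem finrank_map_le_of_ker_le {V W W' : Type*} [AddCommGroup V] [Module K V] [AddCommGroup W]
    [Module K W] [AddCommGroup W'] [Module K W'] (P : Submodule K V) [Module.Finite K P]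
    (f : V →ₗ[K] W) (g : V →ₗ[K] W') (h : LinearMap.ker f ≤ LinearMap.ker g) :
    finrank K (P.map g) ≤ finrank K (P.map f) := by
  have hf := (f.domRestrict P).finrank_range_add_finrank_ker
  have hg := (g.domRestrict P).finrank_range_add_finrank_ker
  rw [LinearMap.range_domRestrict] at hf hg
  have : finrank K (LinearMap.ker (f.domRestrict P)) ≤ finrank K (LinearMap.ker (g.domRestrict P)) :=
    Submodule.finrank_mono fun x hx => h hx
  omega

theorem hilb_mono [Finite σ] {S T : Set (σ → K)} (h : T ⊆ zclosure S) (d : ℕ) :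
    hilb T d ≤ hilb S d := by
  refine finrank_map_le_of_ker_le _ _ _ fun p hp => ?_
  rw [LinearMap.mem_ker] at hp ⊢
  ext t
  rw [evalOn_apply]
  exact h t.2 p fun s hs => by simpa using congrFun hp ⟨s, hs⟩

theorem HasGrowth.mono [Finite σ] {S T : Set (σ → K)} {s : ℕ} (hS : HasGrowth S s)
    (h : T ⊆ zclosure S) : HasGrowth T s :=
  hS.imp fun _ hC d => (hilb_mono h d).trans (hC d)

theorem hilb_pos [Finite σ] {S : Set (σ → K)} (hS : S.Nonempty) (d : ℕ) : 0 < hilb S d := by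
  obtain ⟨s, hs⟩ := hS
  have h1 : evalOn S 1 ∈ polyFun S d := mem_polyFun (by simp)
  have : Nontrivial (polyFun S d) := by
    refine ⟨⟨⟨_, h1⟩, 0, fun h => ?_⟩⟩
    have := congrFun (congrArg Subtype.val h) ⟨s, hs⟩
    simp at this
  exact finrank_pos

/-- Multiplication by `f` embeds the functions of degree at most `d` on `S` into the kernel of
restriction to `T`; it is injective because the ideal of `S` is prime. Rank-nullity for the
restriction does the rest. -/
theorem hilb_add_le [Finite σ] {S T : Set (σ → K)} (hS : PolyIrred S) (hTS : T ⊆ S)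
    {f : MvPolynomial σ K} (hfT : ∀ t ∈ T, eval t f = 0) (hfS : ∃ s ∈ S, eval s f ≠ 0) (d : ℕ) :
    hilb S d + hilb T (d + f.totalDegree) ≤ hilb S (d + f.totalDegree) := by
  set e := f.totalDegree with he
  let R : (S → K) →ₗ[K] (T → K) := LinearMap.funLeft K K (Set.inclusion hTS)
  have hR : ∀ p, R (evalOn S p) = evalOn T p := fun p => by
    ext t; simp [R, LinearMap.funLeft_apply]
  let g := R.domRestrict (polyFun S (d + e))
  have hrange : LinearMap.range g = polyFun T (d + e) := by
    rw [LinearMap.range_domRestrict, polyFun, ← Submodule.map_comp]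
    congr 1
  have hmul : ∀ x ∈ polyFun S d, evalOn S f * x ∈ polyFun S (d + e) := by
    rintro _ ⟨p, hp, rfl⟩
    rw [← evalOn_mul]
    refine mem_polyFun ((totalDegree_mul _ _).trans ?_)
    have := (mem_restrictTotalDegree σ d p).1 hp
    omega
  let φ : polyFun S d →ₗ[K] polyFun S (d + e) :=
    ((LinearMap.mulLeft K (evalOn S f)).domRestrict (polyFun S d)).codRestrict _
      fun x => hmul x x.2
  have hφker : ∀ x, φ x ∈ LinearMap.ker g := by
    rintro ⟨_, p, hp, rfl⟩
    rw [LinearMap.mem_ker]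
    change R (evalOn S f * evalOn S p) = 0
    rw [← evalOn_mul, hR]
    ext t
    simp [hfT t t.2]
  let ψ : polyFun S d →ₗ[K] LinearMap.ker g := φ.codRestrict _ hφker
  have hψ : Function.Injective ψ := by
    refine (injective_iff_map_eq_zero ψ).2 ?_
    rintro ⟨_, p, hp, rfl⟩ h
    have h0 : evalOn S f * evalOn S p = 0 := congrArg (fun x => x.1.1) h
    have h1 : ∀ s ∈ S, eval s f * eval s p = 0 := fun s hs => by
      simpa using congrFun h0 ⟨s, hs⟩
    obtain ⟨s, hs, hne⟩ := hfS
    have h2 := (hS.2 f p h1).resolve_left fun h => hne (h s hs)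
    ext t
    simpa using h2 t t.2
  have h1 := LinearMap.finrank_le_finrank_of_injective hψ
  have h2 := g.finrank_range_add_finrank_ker
  rw [hrange] at h2
  simp only [hilb]
  omega

/-- Iterating `hilb_add_le` gives `j * hilb T d ≤ hilb S (d + j * e)`. With `j = d + 1` the argument
on the right is still linear in `d`, so dividing by `d + 1` lowers the exponent by one. -/
theorem HasGrowth.drop [Finite σ] {S T : Set (σ → K)} {s : ℕ} (hg : HasGrowth S s)
    (hS : PolyIrred S) (hT : T.Nonempty) (hTS : T ⊆ S) {f : MvPolynomial σ K}
    (hfT : ∀ t ∈ T, eval t f = 0) (hfS : ∃ s ∈ S, eval s f ≠ 0) :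
    ∃ s', s = s' + 1 ∧ HasGrowth T s' := by
  obtain ⟨C, hC⟩ := hg
  set e := f.totalDegree
  have hmono : ∀ {a b}, a ≤ b → hilb T a ≤ hilb T b := fun h =>
    Submodule.finrank_mono (polyFun_mono T h)
  have key : ∀ d j, j * hilb T d ≤ hilb S (d + j * e) := by
    intro d j
    induction j with
    | zero => simp
    | succ j ih =>
      have h1 := hilb_add_le hS hTS hfT hfS (d + j * e)
      have h2 : hilb T d ≤ hilb T (d + j * e + e) := hmono (by omega)
      have h3 : d + (j + 1) * e = d + j * e + e := by ring
      rw [h3, Nat.succ_mul]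
      change hilb S (d + j * e) + hilb T (d + j * e + e) ≤ hilb S (d + j * e + e) at h1
      omega
  cases s with
  | zero =>
    exfalso
    -- For exponent zero `hilb S` is bounded by `C`, but `hilb T 0 ≥ 1` makes it at least `C + 1`
    -- somewhere.
    have h1 := key 0 (C + 1)
    have h2 := hC (0 + (C + 1) * e)
    have h3 := hilb_pos hT 0
    simp only [pow_zero, mul_one] at h2
    nlinarith
  | succ s =>
    refine ⟨s, rfl, C * (1 + e) ^ (s + 1), fun d => ?_⟩
    have h1 := (key d (d + 1)).trans (hC _)
    have h2 : d + (d + 1) * e + 1 = (1 + e) * (d + 1) := by ring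
    rw [h2, mul_pow, pow_succ (d + 1)] at h1
    refine Nat.le_of_mul_le_mul_left (h1.trans_eq ?_) (Nat.succ_pos d)
    ring

theorem totalDegree_induction {P : ℕ → MvPolynomial σ K → Prop}
    (hC : ∀ d a, P d (C a)) (hadd : ∀ d p q, P d p → P d q → P d (p + q))
    (hX : ∀ d i p, P d p → P (d + 1) (X i * p)) (d : ℕ) (p : MvPolynomial σ K)
    (hp : p.totalDegree ≤ d) : P d p := by
  have hmon : ∀ (d : ℕ) (u : σ →₀ ℕ) (a : K), u.degree ≤ d → P d (monomial u a) := by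
    intro d
    induction d with
    | zero =>
      intro u a hu
      have : u = 0 := by simpa [Finsupp.degree_eq_zero_iff] using hu
      subst this
      exact hC 0 a
    | succ d ih =>
      intro u a hu
      by_cases h0 : u = 0
      · subst h0
        exact hC _ a
      obtain ⟨i, hi⟩ := Finsupp.ne_iff.1 h0
      have hle : Finsupp.single i 1 ≤ u := by
        rw [Finsupp.single_le_iff]
        exact Nat.one_le_iff_ne_zero.2 hi
      have hu' : u = Finsupp.single i 1 + (u - Finsupp.single i 1) :=
        (add_tsub_cancel_of_le hle).symm
      have hdeg : u.degree = 1 + (u - Finsupp.single i 1).degree := by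
        conv_lhs => rw [hu']
        rw [map_add, Finsupp.degree_single]
      have : monomial u a = X i * monomial (u - Finsupp.single i 1) a := by
        rw [X, monomial_mul, one_mul, ← hu']
      rw [this]
      exact hX _ _ _ (ih _ _ (by omega))
  rw [p.as_sum]
  refine Finset.sum_induction _ (P d) (hadd d) (by simpa using hC d 0) fun u hu => hmon d u _ ?_
  refine le_trans ?_ hp
  exact le_totalDegree hu

theorem finite_map₂ {V W U : Type*} [AddCommGroup V] [Module K V] [AddCommGroup W]
    [Module K W] [AddCommGroup U] [Module K U] (μ : V →ₗ[K] W →ₗ[K] U) (P : Submodule K V)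
    (Q : Submodule K W) [Module.Finite K P] [Module.Finite K Q] :
    Module.Finite K (Submodule.map₂ μ P Q) :=
  Module.Finite.iff_fg.2
    (Submodule.FG.map₂ μ (Module.Finite.iff_fg.1 inferInstance) (Module.Finite.iff_fg.1 inferInstance))

theorem finrank_map₂_le {V W U : Type*} [AddCommGroup V] [Module K V] [AddCommGroup W]
    [Module K W] [AddCommGroup U] [Module K U] (μ : V →ₗ[K] W →ₗ[K] U) (P : Submodule K V)
    (Q : Submodule K W) [Module.Finite K P] [Module.Finite K Q] :
    finrank K (Submodule.map₂ μ P Q) ≤ finrank K P * finrank K Q := by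
  rw [TensorProduct.map₂_eq_range_lift_comp_mapIncl, ← finrank_tensorProduct]
  exact LinearMap.finrank_range_le _

/-- For `p` of degree at most `d`, the function `(s, t) ↦ p (s + t)` is a sum of products of
functions of degree at most `d` on `S` and on `T`, so it lies in the image of a tensor product of
the two spaces. -/
theorem hilb_add_set_le [Finite σ] (S T : Set (σ → K)) (d : ℕ) :
    hilb (S + T) d ≤ hilb S d * hilb T d := by
  let μ : (S → K) →ₗ[K] (T → K) →ₗ[K] (S × T → K) :=
    LinearMap.mk₂ K (fun a b st => a st.1 * b st.2)
      (fun _ _ _ => by ext; simp [add_mul]) (fun _ _ _ => by ext; simp [mul_assoc])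
      (fun _ _ _ => by ext; simp [mul_add]) (fun _ _ _ => by ext; simp [mul_left_comm])
  let pull : MvPolynomial σ K →ₗ[K] (S × T → K) :=
    LinearMap.pi fun st => (aeval (st.1.1 + st.2.1)).toLinearMap
  have hpull : ∀ p (st : S × T), pull p st = eval (st.1.1 + st.2.1) p := fun p st => by
    simp [pull, aeval_eq_eval]
  let M : ℕ → Submodule K (S × T → K) := fun d => Submodule.map₂ μ (polyFun S d) (polyFun T d)
  have hM : ∀ d p, p.totalDegree ≤ d → pull p ∈ M d := by
    refine totalDegree_induction ?_ ?_ ?_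
    · intro d a
      have : pull (C a) = μ (evalOn S (C a)) (evalOn T 1) := by
        ext st; simp [hpull, μ]
      rw [this]
      exact Submodule.apply_mem_map₂ _ (mem_polyFun (by simp)) (mem_polyFun (by simp))
    · intro d p q hp hq
      rw [map_add]
      exact add_mem hp hq
    · intro d i p hp
      let m : (S × T → K) →ₗ[K] (S × T → K) := LinearMap.mulLeft K (pull (X i))
      have hm : pull (X i * p) = m (pull p) := by
        ext st; simp [hpull, m]
      rw [hm]
      suffices h : M d ≤ (M (d + 1)).comap m from h hp
      refine Submodule.map₂_le.2 ?_
      rintro _ ⟨a, ha, rfl⟩ _ ⟨b, hb, rfl⟩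
      have ha' := (mem_restrictTotalDegree σ d a).1 ha
      have hb' := (mem_restrictTotalDegree σ d b).1 hb
      have : m (μ (evalOn S a) (evalOn T b)) =
          μ (evalOn S (X i * a)) (evalOn T b) + μ (evalOn S a) (evalOn T (X i * b)) := by
        ext st; simp [hpull, m, μ]; ring
      rw [Submodule.mem_comap, this]
      have hX : ∀ c : MvPolynomial σ K, c.totalDegree ≤ d → (X i * c).totalDegree ≤ d + 1 :=
        fun c hc => (totalDegree_mul _ _).trans (by rw [totalDegree_X]; omega)
      exact add_mem
        (Submodule.apply_mem_map₂ _ (mem_polyFun (hX a ha')) (mem_polyFun (by omega)))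
        (Submodule.apply_mem_map₂ _ (mem_polyFun (by omega)) (mem_polyFun (hX b hb')))
  calc hilb (S + T) d ≤ finrank K ((restrictTotalDegree σ K d).map pull) := by
        refine finrank_map_le_of_ker_le _ _ _ fun p hp => ?_
        rw [LinearMap.mem_ker] at hp ⊢
        ext ⟨_, s, hs, t, ht, rfl⟩
        simpa [hpull] using congrFun hp (⟨s, hs⟩, ⟨t, ht⟩)
    _ ≤ finrank K (M d) := by
        have : Module.Finite K (M d) := finite_map₂ _ _ _
        refine Submodule.finrank_mono ?_
        rintro _ ⟨p, hp, rfl⟩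
        exact hM d p ((mem_restrictTotalDegree σ d p).1 hp)
    _ ≤ _ := finrank_map₂_le _ _ _

theorem HasGrowth.add [Finite σ] {S T : Set (σ → K)} {s t : ℕ} (hS : HasGrowth S s)
    (hT : HasGrowth T t) : HasGrowth (S + T) (s + t) := by
  obtain ⟨C, hC⟩ := hS
  obtain ⟨D, hD⟩ := hT
  refine ⟨C * D, fun d => (hilb_add_set_le S T d).trans ((Nat.mul_le_mul (hC d) (hD d)).trans_eq ?_)⟩
  ring

theorem hasGrowth_zero [Finite σ] : HasGrowth (0 : Set (σ → K)) 0 := by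
  refine ⟨1, fun d => ?_⟩
  have h := Submodule.finrank_le (polyFun (0 : Set (σ → K)) d)
  have : Fintype (0 : Set (σ → K)) := inferInstanceAs (Fintype ({0} : Set (σ → K)))
  rw [finrank_fintype_fun_eq_card] at h
  have h1 : Fintype.card (0 : Set (σ → K)) = 1 := by
    rw [Fintype.card_eq_one_iff]
    exact ⟨⟨0, rfl⟩, fun y => Subtype.ext y.2⟩
  simp only [pow_zero, mul_one]
  exact h.trans h1.le

theorem HasGrowth.nsmul [Finite σ] {S : Set (σ → K)} {s : ℕ} (hS : HasGrowth S s) (k : ℕ) :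
    HasGrowth (k • S) (k * s) := by
  induction k with
  | zero => simpa using hasGrowth_zero
  | succ k ih =>
    rw [succ_nsmul, Nat.succ_mul]
    exact ih.add hS

/-- For fixed `s`, irreducibility of `T` makes `p` or `q` vanish on `s + T`. If `p` and `q` fail at
`s + t` and `s' + t'`, irreducibility of `S` applied to the translates of `p` by `t` and of `q` by
`t'` gives a contradiction. -/
theorem PolyIrred.add {S T : Set (σ → K)} (hS : PolyIrred S) (hT : PolyIrred T) :
    PolyIrred (S + T) := by
  refine ⟨hS.1.add hT.1, fun p q h => ?_⟩
  have tr : ∀ (v : σ → K) (p : MvPolynomial σ K), ∃ p' : MvPolynomial σ K,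
      ∀ w, eval w p' = eval (v + w) p := fun v p =>
    ⟨aeval (fun i => C (v i) + X i) p, fun w => by
      induction p using MvPolynomial.induction_on with
      | C a => simp
      | add p q hp hq => simp only [map_add, hp, hq]
      | mul_X p i hp => simp only [map_mul, hp, aeval_X, map_add, eval_C, eval_X, Pi.add_apply]⟩
  have h1 : ∀ s ∈ S, (∀ t ∈ T, eval (s + t) p = 0) ∨ ∀ t ∈ T, eval (s + t) q = 0 := by
    intro s hs
    obtain ⟨p', hp'⟩ := tr s p
    obtain ⟨q', hq'⟩ := tr s q
    simpa [hp', hq'] using hT.2 p' q' fun t ht => by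
      rw [hp', hq']
      exact h _ (Set.add_mem_add hs ht)
  by_contra! hcon
  obtain ⟨⟨_, ⟨s, hs, t, ht, rfl⟩, hst⟩, _, ⟨s', hs', t', ht', rfl⟩, hst'⟩ := hcon
  obtain ⟨p', hp'⟩ := tr t p
  obtain ⟨q', hq'⟩ := tr t' q
  have := hS.2 p' q' fun x hx => by
    rw [hp', hq']
    rcases h1 x hx with h | h
    · rw [add_comm t, h t ht, zero_mul]
    · rw [add_comm t', h t' ht', mul_zero]
  rcases this with h | h
  · exact hst (by simpa [hp', add_comm] using h s hs)
  · exact hst' (by simpa [hq', add_comm] using h s' hs')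

theorem polyIrred_zero : PolyIrred (0 : Set (σ → K)) := by
  refine ⟨⟨0, rfl⟩, fun p q h => ?_⟩
  rcases mul_eq_zero.1 (h 0 rfl) with h | h
  · exact Or.inl fun s hs => by rwa [Set.mem_zero.1 hs]
  · exact Or.inr fun s hs => by rwa [Set.mem_zero.1 hs]

theorem PolyIrred.nsmul {S : Set (σ → K)} (hS : PolyIrred S) (k : ℕ) : PolyIrred (k • S) := by
  induction k with
  | zero => simpa using polyIrred_zero
  | succ k ih =>
    rw [succ_nsmul]
    exact ih.add hS

theorem PolyIrred.zclosure {S : Set (σ → K)} (hS : PolyIrred S) : PolyIrred (zclosure S) := by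
  refine ⟨hS.1.mono (subset_zclosure S), fun p q h => ?_⟩
  rcases hS.2 p q fun s hs => h s (subset_zclosure S hs) with h | h
  · exact Or.inl fun v hv => hv p h
  · exact Or.inr fun v hv => hv q h

end Affine

/-! ### Homogeneous components on cones and Noether normalization by linear forms -/

section Cones

variable {K σ : Type*} [Field K]

/-- `S` is stable under multiplication by nonzero scalars. -/
def IsCone (S : Set (σ → K)) : Prop := ∀ c : K, c ≠ 0 → ∀ v ∈ S, c • v ∈ S

theorem eval_smul_of_isHomogeneous {p : MvPolynomial σ K} {n : ℕ} (hp : p.IsHomogeneous n) (c : K)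
    (v : σ → K) : eval (c • v) p = c ^ n * eval v p := by
  rw [eval_eq, eval_eq, Finset.mul_sum]
  refine Finset.sum_congr rfl fun d hd => ?_
  rw [hp.degree_eq_sum_deg_support hd, ← Finset.prod_pow_eq_pow_sum, mul_left_comm,
    ← Finset.prod_mul_distrib]
  simp [mul_pow]

theorem eval_smul_eq_sum (p : MvPolynomial σ K) (c : K) (v : σ → K) :
    eval (c • v) p =
      ∑ i ∈ Finset.range (p.totalDegree + 1), c ^ i * eval v (homogeneousComponent i p) := by
  conv_lhs => rw [← sum_homogeneousComponent p, map_sum]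
  exact Finset.sum_congr rfl fun i _ =>
    eval_smul_of_isHomogeneous (homogeneousComponent_isHomogeneous i p) c v

/-- Restricting `p` to the line through `v` turns its homogeneous components into coefficients of a
polynomial in one variable, whose zeros can be counted. -/
theorem exists_scalar_poly (p : MvPolynomial σ K) (v : σ → K) :
    ∃ P : Polynomial K, (∀ c, P.eval c = eval (c • v) p) ∧
      ∀ i, P.coeff i = eval v (homogeneousComponent i p) := by
  refine ⟨∑ i ∈ Finset.range (p.totalDegree + 1),
    Polynomial.monomial i (eval v (homogeneousComponent i p)), fun c => ?_, fun i => ?_⟩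
  · rw [eval_smul_eq_sum, Polynomial.eval_finsetSum]
    simp [mul_comm]
  · rw [Polynomial.finsetSum_coeff]
    simp only [Polynomial.coeff_monomial, Finset.sum_ite_eq', Finset.mem_range]
    split_ifs with h
    · rfl
    · rw [homogeneousComponent_eq_zero _ _ (by omega), map_zero]

theorem IsCone.eval_homogeneousComponent [Infinite K] {S : Set (σ → K)} (hS : IsCone S)
    {p : MvPolynomial σ K} (hp : ∀ s ∈ S, eval s p = 0) (i : ℕ) :
    ∀ s ∈ S, eval s (homogeneousComponent i p) = 0 := by
  intro s hs
  obtain ⟨P, hP, hPc⟩ := exists_scalar_poly p s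
  have h0 : P = 0 := by
    refine Polynomial.eq_zero_of_infinite_isRoot P (Set.Infinite.mono ?_
      (Set.finite_singleton (0 : K)).infinite_compl)
    intro c hc
    exact (hP c).trans (hp _ (hS c hc s hs))
  rw [← hPc, h0, Polynomial.coeff_zero]

theorem homogeneousComponent_mul_linear {l : MvPolynomial σ K} (hl : l.IsHomogeneous 1)
    (c : MvPolynomial σ K) (n : ℕ) :
    homogeneousComponent (n + 1) (c * l) = homogeneousComponent n c * l := by
  conv_lhs => rw [← sum_homogeneousComponent c, Finset.sum_mul, map_sum]
  have : ∀ i, homogeneousComponent (n + 1) (homogeneousComponent i c * l) =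
      if i = n then homogeneousComponent i c * l else 0 := fun i => by
    rw [homogeneousComponent_of_mem ((homogeneousComponent_isHomogeneous i c).mul hl)]
    simp [eq_comm]
  simp only [this, Finset.sum_ite_eq', Finset.mem_range]
  split_ifs with h
  · rfl
  · rw [homogeneousComponent_eq_zero _ _ (by omega), zero_mul]

theorem finrank_restrictTotalDegree_le (m d : ℕ) :
    finrank K (restrictTotalDegree (Fin m) K d) ≤ (d + 1) ^ m := by
  classical
  let F : Finset (MvPolynomial (Fin m) K) :=
    (Fintype.piFinset fun _ : Fin m => Finset.range (d + 1)).image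
      fun u => monomial (Finsupp.equivFunOnFinite.symm u) 1
  have hle : restrictTotalDegree (Fin m) K d ≤ Submodule.span K (F : Set (MvPolynomial (Fin m) K)) := by
    intro p hp
    rw [p.as_sum]
    refine Submodule.sum_mem _ fun u hu => ?_
    have : monomial u (coeff u p) = coeff u p • monomial u (1 : K) := by
      rw [smul_monomial, smul_eq_mul, mul_one]
    rw [this]
    refine Submodule.smul_mem _ _ (Submodule.subset_span ?_)
    simp only [F, Finset.coe_image, Set.mem_image, Finset.mem_coe, Fintype.mem_piFinset,
      Finset.mem_range]
    refine ⟨u, fun i => ?_, by congr 1; ext; simp⟩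
    have h1 := restrictTotalDegree_le_restrictDegree (σ := Fin m) (R := K) d hp
    rw [mem_restrictDegree] at h1
    exact Nat.lt_succ_of_le (h1 u hu i)
  calc _ ≤ finrank K (Submodule.span K (F : Set (MvPolynomial (Fin m) K))) :=
        Submodule.finrank_mono hle
    _ ≤ F.card := finrank_span_finset_le_card F
    _ ≤ _ := Finset.card_image_le
    _ = _ := by simp

/-- By the Nullstellensatz every coordinate is nilpotent modulo the ideal of `S` and the `l j`,
whose only possible common zero is the origin. Taking the component of degree `M + 1` makes the
coefficients homogeneous, since the ideal of a cone is stable under taking components. -/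
theorem exists_pow_eq_sum_of_inter [IsAlgClosed K] [Finite σ] {S : Set (σ → K)}
    (hcl : zclosure S ⊆ S) (hcone : IsCone S) {m : ℕ} (l : Fin m → MvPolynomial σ K)
    (hl : ∀ j, (l j).IsHomogeneous 1) (h0 : ∀ s ∈ S, (∀ j, eval s (l j) = 0) → s = 0) (i : σ) :
    ∃ (M : ℕ) (g : Fin m → MvPolynomial σ K), (∀ j, (g j).IsHomogeneous M) ∧
      ∀ s ∈ S, s i ^ (M + 1) = ∑ j, eval s (g j) * eval s (l j) := by
  let J : Ideal (MvPolynomial σ K) := vanishingIdeal K S ⊔ Ideal.span (Set.range l)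
  have hX : X i ∈ J.radical := by
    rw [← vanishingIdeal_zeroLocus_eq_radical (K := K), mem_vanishingIdeal_iff]
    intro x hx
    have hxS : x ∈ S := hcl fun p hp => by
      simpa [aeval_eq_eval] using hx p (le_sup_left (a := vanishingIdeal K S)
        (mem_vanishingIdeal_iff.2 fun s hs => by simpa [aeval_eq_eval] using hp s hs))
    have hx0 : x = 0 := h0 x hxS fun j => by
      simpa [aeval_eq_eval] using hx (l j) (le_sup_right (a := vanishingIdeal K S)
        (Ideal.subset_span ⟨j, rfl⟩))
    simp [hx0]
  obtain ⟨M, hM⟩ := hX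
  have hM' : X i ^ (M + 1) ∈ J := by
    rw [pow_succ]
    exact J.mul_mem_right _ hM
  obtain ⟨h, hh, g, hg, hhg⟩ := Submodule.mem_sup.1 hM'
  obtain ⟨c, rfl⟩ := (Ideal.mem_span_range_iff_exists_fun).1 hg
  refine ⟨M, fun j => homogeneousComponent M (c j), fun j => homogeneousComponent_isHomogeneous _ _,
    fun s hs => ?_⟩
  have h1 : homogeneousComponent (M + 1) (X i ^ (M + 1) : MvPolynomial σ K) = X i ^ (M + 1) :=
    homogeneousComponent_eq_self (isHomogeneous_X_pow i (M + 1))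
  rw [← hhg, map_add, map_sum, hhg] at h1
  simp only [homogeneousComponent_mul_linear (hl _)] at h1
  have h2 := congrArg (eval s) h1
  rw [map_add, hcone.eval_homogeneousComponent (fun s hs => by
    simpa [aeval_eq_eval] using hh s hs) _ s hs, zero_add] at h2
  simpa using h2.symm

/-- Noether normalization with a degree count: the functions on `S` form a module over the
polynomials in the `l j`, generated by those of degree at most `N`, so degree `d` costs at most a
constant times the number of monomials of degree at most `d` in `m` variables. -/
theorem hasGrowth_of_inter [IsAlgClosed K] [Finite σ] {S : Set (σ → K)}
    (hcl : zclosure S ⊆ S) (hcone : IsCone S) {m : ℕ} (l : Fin m → MvPolynomial σ K)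
    (hl : ∀ j, (l j).IsHomogeneous 1) (h0 : ∀ s ∈ S, (∀ j, eval s (l j) = 0) → s = 0) :
    HasGrowth S m := by
  have := Fintype.ofFinite σ
  choose M g hg hpow using exists_pow_eq_sum_of_inter hcl hcone l hl h0
  -- A monomial of degree above `N` has some exponent exceeding `M i`, so `hpow` applies to it; each
  -- rewriting splits off one `l j` and lowers the remaining degree by one.
  let N := ∑ i, M i
  let L : MvPolynomial (Fin m) K →ₗ[K] (S → K) := (evalOn S) ∘ₗ (aeval l).toLinearMap
  have hL : ∀ q, L q = evalOn S (aeval l q) := fun _ => rfl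
  let T : ℕ → Submodule K (S → K) := fun d =>
    Submodule.map₂ (LinearMap.mul K (S → K)) (polyFun S N) ((restrictTotalDegree (Fin m) K d).map L)
  have hTl : ∀ d j x, x ∈ T d → x * evalOn S (l j) ∈ T (d + 1) := by
    intro d j x hx
    suffices h : T d ≤ (T (d + 1)).comap (LinearMap.mulRight K (evalOn S (l j))) from h hx
    refine Submodule.map₂_le.2 ?_
    rintro a ha _ ⟨q, hq, rfl⟩
    have : (LinearMap.mulRight K (evalOn S (l j))) ((LinearMap.mul K (S → K)) a (L q)) =
        LinearMap.mul K (S → K) a (L (q * X j)) := by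
      simp [hL, evalOn_mul, mul_assoc]
    rw [Submodule.mem_comap, this]
    refine Submodule.apply_mem_map₂ _ ha (Submodule.mem_map_of_mem ?_)
    rw [SetLike.mem_coe, mem_restrictTotalDegree] at *
    exact (totalDegree_mul _ _).trans (by rw [totalDegree_X]; omega)
  have hmon : ∀ d (u : σ →₀ ℕ), u.degree ≤ d → evalOn S (monomial u 1) ∈ T d := by
    intro d
    have small : ∀ d (u : σ →₀ ℕ), u.degree ≤ N → evalOn S (monomial u 1) ∈ T d := by
      intro d u hu
      have : evalOn S (monomial u 1) = LinearMap.mul K (S → K) (evalOn S (monomial u 1)) (L 1) := by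
        rw [hL, map_one (aeval l), LinearMap.mul_apply', ← evalOn_mul, mul_one]
      rw [this]
      refine Submodule.apply_mem_map₂ _ (mem_polyFun ?_) (Submodule.mem_map_of_mem ?_)
      · rwa [totalDegree_monomial _ one_ne_zero]
      · rw [mem_restrictTotalDegree]; simp
    induction d with
    | zero => exact fun u hu => small _ _ (by omega)
    | succ d ih =>
      intro u hu
      by_cases huN : u.degree ≤ N
      · exact small _ _ huN
      obtain ⟨i, hi⟩ : ∃ i, M i + 1 ≤ u i := by
        by_contra! hcon
        refine huN ?_
        rw [Finsupp.degree_eq_sum]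
        exact Finset.sum_le_sum fun i _ => by have := hcon i; omega
      obtain ⟨v, rfl⟩ : ∃ v, u = Finsupp.single i (M i + 1) + v :=
        ⟨_, (add_tsub_cancel_of_le (Finsupp.single_le_iff.2 hi)).symm⟩
      rw [map_add, Finsupp.degree_single] at hu
      have heq : evalOn S (monomial (Finsupp.single i (M i + 1) + v) 1) =
          ∑ j, evalOn S (g i j * monomial v 1) * evalOn S (l j) := by
        ext s
        have : (monomial (Finsupp.single i (M i + 1) + v) 1 : MvPolynomial σ K) =
            X i ^ (M i + 1) * monomial v 1 := by
          rw [X_pow_eq_monomial, monomial_mul, one_mul]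
        rw [this, evalOn_apply, map_mul, map_pow, eval_X, hpow i s s.2, Finset.sum_apply,
          Finset.sum_mul]
        refine Finset.sum_congr rfl fun j _ => ?_
        rw [Pi.mul_apply, evalOn_apply, evalOn_apply, map_mul]
        ring
      rw [heq]
      refine Submodule.sum_mem _ fun j _ => hTl d j _ ?_
      have hdeg : (g i j * monomial v 1).totalDegree ≤ d := by
        refine (totalDegree_mul _ _).trans ?_
        rw [totalDegree_monomial _ one_ne_zero]
        have := (hg i j).totalDegree_le
        change _ + v.degree ≤ d
        omega
      rw [as_sum (g i j * monomial v 1), map_sum]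
      refine Submodule.sum_mem _ fun w hw => ?_
      have : monomial w (coeff w (g i j * monomial v 1)) =
          coeff w (g i j * monomial v 1) • monomial w (1 : K) := by
        rw [smul_monomial, smul_eq_mul, mul_one]
      rw [this, map_smul]
      exact Submodule.smul_mem _ _ (ih w ((le_totalDegree hw).trans hdeg))
  have hT : ∀ d, polyFun S d ≤ T d := by
    rintro d _ ⟨p, hp, rfl⟩
    rw [as_sum p, map_sum]
    refine Submodule.sum_mem _ fun w hw => ?_
    have : monomial w (coeff w p) = coeff w p • monomial w (1 : K) := by
      rw [smul_monomial, smul_eq_mul, mul_one]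
    rw [this, map_smul]
    exact Submodule.smul_mem _ _ (hmon d w
      ((le_totalDegree hw).trans ((mem_restrictTotalDegree σ d p).1 hp)))
  refine ⟨hilb S N, fun d => ?_⟩
  have : Module.Finite K (T d) := finite_map₂ _ _ _
  calc hilb S d ≤ finrank K (T d) := Submodule.finrank_mono (hT d)
    _ ≤ hilb S N * finrank K ((restrictTotalDegree (Fin m) K d).map L) := finrank_map₂_le _ _ _
    _ ≤ _ := Nat.mul_le_mul_left _ ((Submodule.finrank_map_le _ _).trans
      (finrank_restrictTotalDegree_le m d))

end Cones

/-! ### Chevalley's theorem for sums of closed sets -/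

section Chevalley

variable {K σ : Type*} [Field K]

theorem mem_nsmul_iff_exists {V : Type*} [AddCommMonoid V] (S : Set V) (k : ℕ) (v : V) :
    v ∈ k • S ↔ ∃ x : Fin k → V, (∀ i, x i ∈ S) ∧ ∑ i, x i = v := by
  induction k generalizing v with
  | zero => simp [eq_comm]
  | succ k ih =>
    rw [succ_nsmul, Set.mem_add]
    constructor
    · rintro ⟨a, ha, b, hb, rfl⟩
      obtain ⟨x, hx, rfl⟩ := (ih a).1 ha
      refine ⟨Fin.snoc x b, fun i => ?_, by simp [Fin.sum_univ_castSucc]⟩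
      refine Fin.lastCases ?_ (fun i => ?_) i
      · simpa using hb
      · simpa using hx i
    · rintro ⟨x, hx, rfl⟩
      exact ⟨_, (ih _).2 ⟨fun i => x i.castSucc, fun i => hx _, rfl⟩, _, hx (Fin.last k),
        (Fin.sum_univ_castSucc x).symm⟩

open PrimeSpectrum in
-- `k • S` is the image of the closed set `S ^ k` under addition, whose comorphism is `φ`;
-- Chevalley's theorem on prime spectra makes the image constructible, and closed points translate
-- this back.
theorem exists_constructible_nsmul [IsAlgClosed K] [Finite σ] {S : Set (σ → K)} (hcl : zclosure S ⊆ S) (k : ℕ) :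
    ∃ D : ConstructibleSetData (MvPolynomial σ K), ∀ v : σ → K,
      v ∈ k • S ↔ ∃ C ∈ D, (∀ i, eval v (C.g i) = 0) ∧ eval v C.f ≠ 0 := by
  let φ : MvPolynomial σ K →ₐ[K] MvPolynomial (Fin k × σ) K := aeval fun j => ∑ i, X (i, j)
  have hφ : ∀ p (x : Fin k × σ → K), eval x (φ p) = eval (∑ i, fun j => x (i, j)) p := by
    intro p x
    induction p using MvPolynomial.induction_on with
    | C a => simp [φ]
    | add p q hp hq => simp only [map_add, hp, hq]
    | mul_X p i hp => simp only [map_mul, hp]; simp [φ]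
  let J : Ideal (MvPolynomial (Fin k × σ) K) :=
    Ideal.span {q | ∃ p ∈ MvPolynomial.vanishingIdeal K S, ∃ i : Fin k, q = rename (fun j => (i, j)) p}
  have hfp : φ.toRingHom.FinitePresentation := by
    refine RingHom.FinitePresentation.of_finiteType.1
      (RingHom.FiniteType.of_comp_finiteType (f := (C : K →+* MvPolynomial σ K)) ?_)
    have : φ.toRingHom.comp C = algebraMap K (MvPolynomial (Fin k × σ) K) :=
      φ.comp_algebraMap
    rw [this, RingHom.finiteType_algebraMap]
    infer_instance
  have hJ : Topology.IsConstructible (PrimeSpectrum.zeroLocus (J : Set (MvPolynomial (Fin k × σ) K))) := by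
    rw [← Topology.isConstructible_compl]
    exact (isRetrocompact_zeroLocus_compl_of_fg (IsNoetherian.noetherian J)).isConstructible
      (isClosed_zeroLocus _).isOpen_compl
  obtain ⟨D, hD⟩ := exists_constructibleSetData_iff.2 (isConstructible_comap_image hfp hJ)
  refine ⟨D, fun v => ?_⟩
  have hv : v ∈ k • S ↔ pointToPoint (k := K) v ∈ D.toSet := by
    rw [hD, mem_nsmul_iff_exists]
    constructor
    · rintro ⟨x, hx, rfl⟩
      refine ⟨pointToPoint (k := K) fun ij => x ij.1 ij.2, ?_, ?_⟩
      · rw [mem_zeroLocus]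
        refine Ideal.span_le.2 ?_
        rintro _ ⟨p, hp, i, rfl⟩
        refine (mem_vanishingIdeal_singleton_iff _ _).2 ?_
        rw [aeval_rename]
        exact hp _ (hx i)
      · ext p
        change φ p ∈ MvPolynomial.vanishingIdeal K _ ↔ p ∈ MvPolynomial.vanishingIdeal K _
        rw [mem_vanishingIdeal_singleton_iff, mem_vanishingIdeal_singleton_iff, aeval_eq_eval,
          aeval_eq_eval]
        exact Eq.congr_left (hφ p _)
    · rintro ⟨P, hP, hPv⟩
      -- A prime over the point `v` need not be closed. A maximal ideal above it is a point `x` by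
      -- the Nullstellensatz, and it still lies over `v` because it contains the images of all `X j
      -- - C (v j)`.
      obtain ⟨m, hm, hPm⟩ := Ideal.exists_le_maximal P.asIdeal P.2.ne_top
      obtain ⟨x, rfl⟩ := isMaximal_iff_eq_vanishingIdeal_singleton.1 hm
      refine ⟨fun i j => x (i, j), fun i => hcl fun p hp => ?_, ?_⟩
      · have h1 : rename (fun j => (i, j)) p ∈ P.asIdeal := hP (Ideal.subset_span
          ⟨p, fun s hs => by simpa [aeval_eq_eval] using hp s hs, i, rfl⟩)
        have h2 := (mem_vanishingIdeal_singleton_iff _ _).1 (hPm h1)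
        rwa [aeval_rename, aeval_eq_eval] at h2
      · funext j
        have h1 : X j - C (v j) ∈ (pointToPoint (k := K) v).asIdeal :=
          (mem_vanishingIdeal_singleton_iff _ _).2 (by simp)
        rw [← hPv] at h1
        have h2 := (mem_vanishingIdeal_singleton_iff _ _).1 (hPm h1)
        rw [aeval_eq_eval] at h2
        have h3 := (hφ _ x).symm.trans h2
        rw [map_sub, eval_X, eval_C, sub_eq_zero] at h3
        exact h3
  have hmem : ∀ p, p ∈ (pointToPoint (k := K) v).asIdeal ↔ eval v p = 0 := fun p => by
    rw [← aeval_eq_eval]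
    exact mem_vanishingIdeal_singleton_iff v p
  rw [hv, ConstructibleSetData.toSet]
  simp only [Set.mem_iUnion, BasicConstructibleSetData.toSet, Set.mem_sdiff, mem_zeroLocus,
    Set.singleton_subset_iff, SetLike.mem_coe, Set.range_subset_iff, hmem, exists_prop, ne_eq]

/-- Some locally closed piece is dense in `S`; its equations `C.g` then hold on the whole closure,
and `C.f ≠ 0` cuts out an open part contained in `S`. -/
theorem exists_nonvanishing_subset {S : Set (σ → K)} (hS : PolyIrred S)
    {D : PrimeSpectrum.ConstructibleSetData (MvPolynomial σ K)} (hD : ∀ v : σ → K,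
      v ∈ S ↔ ∃ C ∈ D, (∀ i, eval v (C.g i) = 0) ∧ eval v C.f ≠ 0) :
    ∃ f : MvPolynomial σ K, (∃ s ∈ S, eval s f ≠ 0) ∧ ∀ v ∈ zclosure S, eval v f ≠ 0 → v ∈ S := by
  classical
  let P (C : PrimeSpectrum.BasicConstructibleSetData (MvPolynomial σ K)) : Set (σ → K) :=
    {v | (∀ i, eval v (C.g i) = 0) ∧ eval v C.f ≠ 0}
  have hprod : ∀ (E : Finset (PrimeSpectrum.BasicConstructibleSetData (MvPolynomial σ K)))
      (h : PrimeSpectrum.BasicConstructibleSetData (MvPolynomial σ K) → MvPolynomial σ K),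
      (∀ s ∈ S, ∏ C ∈ E, eval s (h C) = 0) → ∃ C ∈ E, ∀ s ∈ S, eval s (h C) = 0 := by
    intro E h
    induction E using Finset.induction_on with
    | empty =>
      intro h1
      obtain ⟨s, hs⟩ := hS.1
      simpa using h1 s hs
    | insert C E hC ih =>
      intro h1
      rcases hS.2 (h C) (∏ C ∈ E, h C) (fun s hs => by
        have := h1 s hs
        rwa [Finset.prod_insert hC, ← map_prod] at this) with h2 | h2
      · exact ⟨C, Finset.mem_insert_self _ _, h2⟩
      · obtain ⟨C', hC', h3⟩ := ih fun s hs => by rw [← map_prod]; exact h2 s hs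
        exact ⟨C', Finset.mem_insert_of_mem hC', h3⟩
  -- If no piece were dense, each would have a polynomial vanishing on it but not on `S`; their
  -- product vanishes on `S`, against irreducibility.
  obtain ⟨C, hCD, hC⟩ : ∃ C ∈ D, ∀ h : MvPolynomial σ K, (∀ v ∈ P C, eval v h = 0) →
      ∀ s ∈ S, eval s h = 0 := by
    by_contra! hcon
    choose! h h1 h2 using hcon
    obtain ⟨C, hC, hC'⟩ := hprod D h fun s hs => by
      obtain ⟨C, hC, hs⟩ := (hD s).1 hs
      exact Finset.prod_eq_zero hC (h1 C hC s hs)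
    obtain ⟨s, hs, hne⟩ := h2 C hC
    exact hne (hC' s hs)
  refine ⟨C.f, ?_, fun v hv hf => (hD v).2 ⟨C, hCD, fun i => hv _ (hC _ fun w hw => hw.1 i), hf⟩⟩
  by_contra! hcon
  obtain ⟨s, hs⟩ := hS.1
  have := hC 1 (fun v hv => absurd (hcon v ((hD v).2 ⟨C, hCD, hv⟩)) hv.2) s hs
  simp at this

end Chevalley

/-! ### Affine cones over subsets of projective space -/

namespace PSpace

variable {K : Type*} [Field K] {r : ℕ}

/-- The affine cone over `Y`: the origin and the representatives of the points of `Y`. -/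
def cone (Y : Set (PSpace K r)) : Set (Fin (r + 1) → K) :=
  {v | ∀ h : v ≠ 0, Projectivization.mk K v h ∈ Y}

theorem zero_mem_cone (Y : Set (PSpace K r)) : (0 : Fin (r + 1) → K) ∈ cone Y :=
  fun h => absurd rfl h

theorem isCone_cone (Y : Set (PSpace K r)) : IsCone (cone Y) := by
  intro c hc v hv h
  have hv0 : v ≠ 0 := right_ne_zero_of_smul h
  have : Projectivization.mk K (c • v) h = Projectivization.mk K v hv0 :=
    (Projectivization.mk_eq_mk_iff' _ _ _ _ _).2 ⟨c, rfl⟩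
  rw [this]
  exact hv hv0

theorem rep_mem_cone {Y : Set (PSpace K r)} {p : PSpace K r} : p.rep ∈ cone Y ↔ p ∈ Y := by
  constructor
  · intro h
    have := h p.rep_nonzero
    rwa [Projectivization.mk_rep] at this
  · intro h _
    rwa [Projectivization.mk_rep]

theorem exists_eq_smul_rep (v : Fin (r + 1) → K) (hv : v ≠ 0) :
    ∃ c : K, c ≠ 0 ∧ v = c • (Projectivization.mk K v hv).rep := by
  obtain ⟨a, ha⟩ := Projectivization.exists_smul_eq_mk_rep K v hv
  refine ⟨(a⁻¹ : Kˣ), Units.ne_zero _, ?_⟩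
  rw [← ha]
  exact (inv_smul_smul a v).symm

theorem cone_mono {Y Z : Set (PSpace K r)} (h : Y ⊆ Z) : cone Y ⊆ cone Z :=
  fun _ hv h0 => h (hv h0)

theorem cone_rep_mem {S : Set (Fin (r + 1) → K)} (hS : IsCone S) (h0 : 0 ∈ S) :
    cone {q : PSpace K r | q.rep ∈ S} = S := by
  ext v
  by_cases hv : v = 0
  · subst hv
    exact ⟨fun _ => h0, fun _ => zero_mem_cone _⟩
  obtain ⟨c, hc, hcv⟩ := exists_eq_smul_rep v hv
  constructor
  · intro h
    rw [hcv]
    exact hS c hc _ (h hv)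
  · intro h _
    have h1 := hS c⁻¹ (inv_ne_zero hc) v h
    have h2 : c⁻¹ • v = (Projectivization.mk K v hv).rep := by
      conv_lhs => rw [hcv]
      exact inv_smul_smul₀ hc _
    rw [h2] at h1
    exact h1

theorem isClosed_iff_isAlgebraic {Z : Set (PSpace K r)} : IsClosed Z ↔ IsAlgebraic Z := by
  rw [← isOpen_compl_iff]
  change IsAlgebraic Zᶜᶜ ↔ _
  rw [compl_compl]

theorem isOpen_eval_ne_zero {f : MvPolynomial (Fin (r + 1)) K} {d : ℕ} (hf : f.IsHomogeneous d) :
    IsOpen {q : PSpace K r | eval q.rep f ≠ 0} := by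
  rw [← isClosed_compl_iff, isClosed_iff_isAlgebraic]
  refine ⟨{f}, ?_, ?_⟩
  · rintro _ rfl
    exact ⟨d, hf⟩
  · ext q
    simp [zeros]

theorem exists_eval_ne_zero_of_notMem {Z : Set (PSpace K r)} (hZ : IsClosed Z) {p : PSpace K r}
    (hp : p ∉ Z) : ∃ (f : MvPolynomial (Fin (r + 1)) K) (d : ℕ), f.IsHomogeneous d ∧
      (∀ q ∈ Z, eval q.rep f = 0) ∧ eval p.rep f ≠ 0 := by
  obtain ⟨S, hS, rfl⟩ := isClosed_iff_isAlgebraic.1 hZ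
  simp only [zeros, Set.mem_ofPred_eq, not_forall] at hp
  obtain ⟨f, hf, hne⟩ := hp
  obtain ⟨d, hd⟩ := hS f hf
  exact ⟨f, d, hd, fun q hq => hq f hf, hne⟩

theorem eval_eq_zero_iff_rep {f : MvPolynomial (Fin (r + 1)) K} {d : ℕ} (hf : f.IsHomogeneous d)
    {v : Fin (r + 1) → K} (hv : v ≠ 0) :
    eval v f = 0 ↔ eval (Projectivization.mk K v hv).rep f = 0 := by
  obtain ⟨c, hc, hcv⟩ := exists_eq_smul_rep v hv
  conv_lhs => rw [hcv, eval_smul_of_isHomogeneous hf]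
  simp [hc]

theorem zclosure_cone_subset (Y : Set (PSpace K r)) : zclosure (cone Y) ⊆ cone (closure Y) := by
  intro v hv h0
  by_contra hcon
  obtain ⟨f, d, hf, hfY, hfv⟩ := exists_eval_ne_zero_of_notMem isClosed_closure hcon
  obtain ⟨i, hi⟩ := Function.ne_iff.1 h0
  -- The factor `X i` forces vanishing at the origin, where a constant `f` might not vanish.
  have h1 := hv (f * X i) fun w hw => by
    rw [map_mul, eval_X]
    by_cases hw0 : w = 0
    · simp [hw0]
    · rw [(eval_eq_zero_iff_rep hf hw0).2 (hfY _ (subset_closure (hw hw0))), zero_mul]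
  rw [map_mul, eval_X] at h1
  exact hfv ((eval_eq_zero_iff_rep hf h0).1 ((mul_eq_zero.1 h1).resolve_right hi))

theorem cone_closure [Infinite K] (Y : Set (PSpace K r)) :
    cone (closure Y) = zclosure (cone Y) := by
  refine Set.Subset.antisymm (fun v hv p hp => ?_) (zclosure_cone_subset Y)
  by_cases hv0 : v = 0
  · subst hv0
    exact hp 0 (zero_mem_cone Y)
  rw [← sum_homogeneousComponent p, map_sum]
  refine Finset.sum_eq_zero fun i _ => ?_
  by_contra hne
  have hhom := homogeneousComponent_isHomogeneous i p
  have hY : Y ⊆ {q : PSpace K r | eval q.rep (homogeneousComponent i p) ≠ 0}ᶜ := fun q hq h =>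
    h ((isCone_cone Y).eval_homogeneousComponent hp i _ (rep_mem_cone.2 hq))
  exact closure_minimal hY (isOpen_eval_ne_zero hhom).isClosed_compl (hv hv0)
    fun h => hne ((eval_eq_zero_iff_rep hhom hv0).2 h)

/-- If neither factor vanishes on the cone, each has a component that is nonzero somewhere on `Y`.
By irreducibility both components are nonzero at a common `x`, so both factors restrict to nonzero
polynomials on the line of `x`. -/
theorem polyIrred_cone [Infinite K] {Y : Set (PSpace K r)} (hY : IsIrreducible Y) :
    PolyIrred (cone Y) := by
  refine ⟨⟨0, zero_mem_cone Y⟩, fun f g hfg => ?_⟩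
  by_contra! hcon
  obtain ⟨⟨v, hv, hfv⟩, w, hw, hgw⟩ := hcon
  have key : ∀ (f : MvPolynomial (Fin (r + 1)) K) (v), v ∈ cone Y → eval v f ≠ 0 →
      ∃ i, ∃ q ∈ Y, eval q.rep (homogeneousComponent i f) ≠ 0 := by
    intro f v hv hfv
    by_contra! hcon
    by_cases hv0 : v = 0
    · obtain ⟨q, hq⟩ := hY.1
      have := hcon 0 q hq
      rw [homogeneousComponent_zero, eval_C] at this
      rw [hv0, eval_zero, constantCoeff_eq] at hfv
      exact hfv this
    · refine hfv ?_
      rw [← sum_homogeneousComponent f, map_sum]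
      exact Finset.sum_eq_zero fun i _ => (eval_eq_zero_iff_rep
        (homogeneousComponent_isHomogeneous i f) hv0).2 (hcon i _ (hv hv0))
  obtain ⟨i, p, hp, hpi⟩ := key f v hv hfv
  obtain ⟨j, q, hq, hqj⟩ := key g w hw hgw
  obtain ⟨x, hx, hxi, hxj⟩ := hY.2 _ _
    (isOpen_eval_ne_zero (homogeneousComponent_isHomogeneous i f))
    (isOpen_eval_ne_zero (homogeneousComponent_isHomogeneous j g)) ⟨p, hp, hpi⟩ ⟨q, hq, hqj⟩
  obtain ⟨P, hP, hPc⟩ := exists_scalar_poly f x.rep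
  obtain ⟨Q, hQ, hQc⟩ := exists_scalar_poly g x.rep
  have hP0 : P ≠ 0 := fun h => hxi (by rw [← hPc, h, Polynomial.coeff_zero])
  have hQ0 : Q ≠ 0 := fun h => hxj (by rw [← hQc, h, Polynomial.coeff_zero])
  refine mul_ne_zero (mul_ne_zero hP0 hQ0) Polynomial.X_ne_zero (Polynomial.funext fun c => ?_)
  rw [Polynomial.eval_mul, Polynomial.eval_mul, Polynomial.eval_X, Polynomial.eval_zero]
  by_cases hc : c = 0
  · rw [hc, mul_zero]
  · rw [hP, hQ, hfg _ (isCone_cone Y c hc _ (rep_mem_cone.2 hx)), zero_mul]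

theorem isIrreducible_of_polyIrred {Y : Set (PSpace K r)} (hne : Y.Nonempty)
    (hY : PolyIrred (cone Y)) : IsIrreducible Y := by
  refine ⟨hne, ?_⟩
  rintro U V hU hV ⟨p, hp, hpU⟩ ⟨q, hq, hqV⟩
  obtain ⟨f, d, hf, hfU, hfp⟩ := exists_eval_ne_zero_of_notMem hU.isClosed_compl
    (fun h => h hpU : p ∉ Uᶜ)
  obtain ⟨g, e, hg, hgV, hgq⟩ := exists_eval_ne_zero_of_notMem hV.isClosed_compl
    (fun h => h hqV : q ∉ Vᶜ)
  by_contra hcon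
  have hz : ∀ x ∈ Y, eval x.rep f * eval x.rep g = 0 := fun x hx => by
    by_cases hxU : x ∈ U
    · by_cases hxV : x ∈ V
      · exact absurd ⟨x, hx, hxU, hxV⟩ hcon
      · rw [hgV x hxV, mul_zero]
    · rw [hfU x hxU, zero_mul]
  obtain ⟨i, hi⟩ := Function.ne_iff.1 p.rep_nonzero
  rcases hY.2 (f * X i) g fun v hv => by
      by_cases hv0 : v = 0
      · simp [hv0]
      · rw [map_mul, eval_X, mul_right_comm, ← map_mul, (eval_eq_zero_iff_rep (hf.mul hg) hv0).2
          (by rw [map_mul]; exact hz _ (hv hv0)), zero_mul] with h | h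
  · have := h p.rep (rep_mem_cone.2 hp)
    rw [map_mul, eval_X] at this
    exact (mul_ne_zero hfp hi) this
  · exact hgq (h q.rep (rep_mem_cone.2 hq))

theorem mem_span_iff_rep {A : Set (PSpace K r)} {q : PSpace K r} :
    q ∈ Projectivization.Subspace.span A ↔
      q.rep ∈ Submodule.span K (Projectivization.rep '' A) := by
  have hmem : ∀ (W : Projectivization.Subspace K (Fin (r + 1) → K)) (p : PSpace K r),
      p ∈ W ↔ p.rep ∈ Projectivization.Subspace.submodule W := fun W p => by
    rw [Projectivization.Subspace.mem_submodule_iff _ p.rep_nonzero, Projectivization.mk_rep]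
  constructor
  · intro h
    have h1 := (Projectivization.Subspace.mem_span q).1 h
      (Projectivization.Subspace.submodule.symm (Submodule.span K (Projectivization.rep '' A)))
      fun a ha => (hmem _ _).2 (by
        rw [OrderIso.apply_symm_apply]
        exact Submodule.subset_span ⟨a, ha, rfl⟩)
    rwa [hmem, OrderIso.apply_symm_apply] at h1
  · intro h
    rw [hmem]
    refine Submodule.span_le.2 ?_ h
    rintro _ ⟨a, ha, rfl⟩
    exact (hmem _ _).1 (Projectivization.Subspace.subset_span A ha)

theorem smul_rep_mem_cone {X : Set (PSpace K r)} {a : PSpace K r} (ha : a ∈ X) (c : K) :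
    c • a.rep ∈ cone X := by
  by_cases hc : c = 0
  · rw [hc, zero_smul]
    exact zero_mem_cone X
  · exact isCone_cone X c hc _ (rep_mem_cone.2 ha)

/-- This turns secant spans into sums of cones, to which the growth estimates apply. -/
theorem mem_nsmul_cone_iff {X : Set (PSpace K r)} {k : ℕ} {v : Fin (r + 1) → K} :
    v ∈ k • cone X ↔ ∃ A : Finset (PSpace K r), (A : Set (PSpace K r)) ⊆ X ∧ A.card ≤ k ∧
      v ∈ Submodule.span K (Projectivization.rep '' (A : Set (PSpace K r))) := by
  classical
  constructor
  · induction k generalizing v with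
    | zero =>
      intro h
      refine ⟨∅, by simp, by simp, ?_⟩
      simpa using h
    | succ k ih =>
      rw [succ_nsmul]
      rintro ⟨w, hw, x, hx, rfl⟩
      obtain ⟨A, hAX, hAc, hwA⟩ := ih hw
      by_cases hx0 : x = 0
      · exact ⟨A, hAX, by omega, by simpa [hx0] using hwA⟩
      obtain ⟨c, hc, hcx⟩ := exists_eq_smul_rep x hx0
      refine ⟨insert (Projectivization.mk K x hx0) A, ?_, ?_, ?_⟩
      · rw [Finset.coe_insert]
        exact Set.insert_subset (hx hx0) hAX
      · exact (Finset.card_insert_le _ _).trans (by omega)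
      · rw [Finset.coe_insert, Set.image_insert_eq]
        refine add_mem (Submodule.span_mono (Set.subset_insert _ _) hwA) ?_
        have h1 : c • (Projectivization.mk K x hx0).rep ∈ Submodule.span K
            (insert (Projectivization.mk K x hx0).rep (Projectivization.rep '' (A : Set (PSpace K r)))) :=
          Submodule.smul_mem _ _ (Submodule.subset_span (Set.mem_insert _ _))
        rwa [← hcx] at h1
  · rintro ⟨A, hAX, hAk, hv⟩
    suffices h : ∀ v ∈ Submodule.span K (Projectivization.rep '' (A : Set (PSpace K r))),
        v ∈ A.card • cone X from
      Set.nsmul_subset_nsmul_right (zero_mem_cone X) hAk (h v hv)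
    clear hv hAk
    induction A using Finset.induction_on with
    | empty => intro v hv; simpa using hv
    | insert a A ha ih =>
      intro v hv
      rw [Finset.coe_insert] at hAX hv
      rw [Set.image_insert_eq, Submodule.mem_span_insert] at hv
      obtain ⟨c, w, hw, rfl⟩ := hv
      rw [Finset.card_insert_of_notMem ha, succ_nsmul, add_comm (c • _)]
      exact Set.add_mem_add (ih (fun x hx => hAX (Set.mem_insert_of_mem _ hx)) w hw)
        (smul_rep_mem_cone (hAX (Set.mem_insert _ _)) c)

theorem IsCone.nsmul {σ : Type*} {S : Set (σ → K)} (hS : IsCone S) (k : ℕ) : IsCone (k • S) := by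
  induction k with
  | zero =>
    intro c _ v hv
    simp only [zero_nsmul, Set.mem_zero] at hv ⊢
    rw [hv, smul_zero]
  | succ k ih =>
    rw [succ_nsmul]
    rintro c hc _ ⟨v, hv, w, hw, rfl⟩
    rw [smul_add]
    exact Set.add_mem_add (ih c hc v hv) (hS c hc w hw)

theorem secantVariety_eq (k : ℕ) (X : Set (PSpace K r)) :
    secantVariety k X = closure {q | q.rep ∈ k • cone X} := by
  simp only [secantVariety, mem_span_iff_rep, mem_nsmul_cone_iff]

theorem zero_mem_nsmul_cone (k : ℕ) (X : Set (PSpace K r)) :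
    (0 : Fin (r + 1) → K) ∈ k • cone X :=
  mem_nsmul_cone_iff.2 ⟨∅, by simp, by simp, zero_mem _⟩

theorem cone_secantVariety [Infinite K] (k : ℕ) (X : Set (PSpace K r)) :
    cone (secantVariety k X) = zclosure (k • cone X) := by
  rw [secantVariety_eq, cone_closure,
    cone_rep_mem (IsCone.nsmul (isCone_cone X) k) (zero_mem_nsmul_cone k X)]

/-! ### Krull dimension and growth of cones -/

instance noetherianSpace : TopologicalSpace.NoetherianSpace (PSpace K r) := by
  let I : TopologicalSpace.Opens (PSpace K r) → Ideal (MvPolynomial (Fin (r + 1)) K) := fun U =>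
    vanishingIdeal K (Projectivization.rep '' (U : Set (PSpace K r))ᶜ)
  have hI : StrictMono I := by
    intro U V hUV
    refine lt_of_le_not_ge (vanishingIdeal_anti_mono (Set.image_mono
      (Set.compl_subset_compl.2 hUV.le))) fun hle => hUV.not_ge fun p hp => ?_
    by_contra hpU
    obtain ⟨f, d, hf, hfV, hfp⟩ := exists_eval_ne_zero_of_notMem V.2.isClosed_compl
      (fun h => h hp : p ∉ (V : Set (PSpace K r))ᶜ)
    have h1 : f ∈ I V := by
      rintro _ ⟨q, hq, rfl⟩
      simpa [aeval_eq_eval] using hfV q hq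
    exact hfp (by simpa [aeval_eq_eval] using hle h1 _ ⟨p, hpU, rfl⟩)
  exact hI.wellFoundedGT

theorem natCast_le_dim_iff {Y : Set (PSpace K r)} (hY : IsClosed Y) {m : ℕ} :
    (m : WithBot ℕ∞) ≤ dim Y ↔
      ∃ l : LTSeries (TopologicalSpace.IrreducibleCloseds (PSpace K r)),
        l.length = m ∧ (l.last : Set (PSpace K r)) ⊆ Y := by
  rw [dim, topologicalKrullDim, Order.le_krullDim_iff]
  constructor
  · rintro ⟨l, rfl⟩
    refine ⟨l.map _ (TopologicalSpace.IrreducibleCloseds.map_strictMono_of_isInducing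
      Topology.IsInducing.subtypeVal), rfl, ?_⟩
    rw [LTSeries.last_map]
    exact closure_minimal (by rintro _ ⟨y, _, rfl⟩; exact y.2) hY
  · rintro ⟨l, rfl, hl⟩
    have hsub : ∀ i, (l i : Set (PSpace K r)) ⊆ Y := fun i =>
      Set.Subset.trans (show (l i : Set (PSpace K r)) ⊆ l.last from l.monotone (Fin.le_last i)) hl
    have him : ∀ i, (Subtype.val : Y → _) '' (Subtype.val ⁻¹' (l i : Set (PSpace K r))) = l i :=
      fun i => by rw [Subtype.image_preimage_coe, Set.inter_eq_right.2 (hsub i)]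
    refine ⟨LTSeries.mk l.length (fun i => ⟨Subtype.val ⁻¹' (l i : Set (PSpace K r)), ?_,
      (l i).isClosed.preimage continuous_subtype_val⟩) ?_, rfl⟩
    · obtain ⟨⟨p, hp⟩, hirr⟩ := (l i).isIrreducible
      refine ⟨⟨⟨p, hsub i hp⟩, hp⟩, ?_⟩
      rintro _ _ ⟨U, hU, rfl⟩ ⟨V, hV, rfl⟩ ⟨x, hx, hxU⟩ ⟨y, hy, hyV⟩
      obtain ⟨z, hz, hzU, hzV⟩ := hirr U V hU hV ⟨x, hx, hxU⟩ ⟨y, hy, hyV⟩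
      exact ⟨⟨z, hsub i hz⟩, hz, hzU, hzV⟩
    · intro i j hij
      have h := l.strictMono hij
      refine lt_of_le_not_ge (fun x hx => h.le hx) fun hle => h.not_ge fun x hx => ?_
      exact hle (show (⟨x, hsub j hx⟩ : Y) ∈ _ from hx)

/-- A linear form that is nonzero at a chosen point of every irreducible component lowers the
dimension; induct on `m`. -/
theorem exists_linear_of_dim_lt [Infinite K] (m : ℕ) {Y : Set (PSpace K r)} (hY : IsClosed Y)
    (hdim : dim Y < (m : WithBot ℕ∞)) :
    ∃ l : Fin m → MvPolynomial (Fin (r + 1)) K, (∀ j, (l j).IsHomogeneous 1) ∧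
      ∀ p ∈ Y, ∃ j, eval p.rep (l j) ≠ 0 := by
  induction m generalizing Y with
  | zero =>
    refine ⟨Fin.elim0, fun j => j.elim0, fun p hp => absurd ?_ hdim.not_ge⟩
    rw [natCast_le_dim_iff hY]
    exact ⟨RelSeries.singleton _ ⟨closure {p}, isIrreducible_singleton.closure, isClosed_closure⟩,
      rfl, closure_minimal (Set.singleton_subset_iff.2 hp) hY⟩
  | succ m ih =>
    obtain ⟨S, hSfin, hScl, hSirr, rfl⟩ :=
      TopologicalSpace.NoetherianSpace.exists_finite_set_isClosed_irreducible hY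
    have := hSfin.to_subtype
    choose p hp using fun Z : S => (hSirr Z Z.2).1
    obtain ⟨φ, hφ⟩ := Module.exists_dual_forall_apply_ne_zero (K := K) (fun Z => (p Z).rep)
      fun Z => (p Z).rep_nonzero
    let f : MvPolynomial (Fin (r + 1)) K := ∑ i, C (φ (Pi.single i 1)) * X i
    have hf : f.IsHomogeneous 1 := IsHomogeneous.sum _ _ _ fun i _ => isHomogeneous_C_mul_X _ _
    have hfφ : ∀ v, eval v f = φ v := fun v => by
      rw [LinearMap.pi_apply_eq_sum_univ φ v]
      simp only [f, map_sum, map_mul, eval_C, eval_X, smul_eq_mul]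
      refine Finset.sum_congr rfl fun i _ => ?_
      rw [mul_comm]
      congr 2
      ext j
      simp [Pi.single_apply, eq_comm]
    obtain ⟨l, hl, hlne⟩ := ih (Y := ⋃₀ S ∩ {q | eval q.rep f ≠ 0}ᶜ)
      (hY.inter (isOpen_eval_ne_zero hf).isClosed_compl) (by
        -- A chain of length `m` in the section lies in a single component `Z`, properly because `f`
        -- is nonzero at the chosen point of `Z`; adjoining `Z` gives a chain of length `m + 1` in
        -- `Y`.
        by_contra! hcon
        rw [natCast_le_dim_iff (hY.inter (isOpen_eval_ne_zero hf).isClosed_compl)] at hcon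
        obtain ⟨l, hlm, hlast⟩ := hcon
        obtain ⟨Z, hZ, hlZ⟩ := (isIrreducible_iff_sUnion_isClosed.1 l.last.isIrreducible)
          hSfin.toFinset (by simpa using hScl) (by
            rw [hSfin.coe_toFinset]
            exact fun x hx => (hlast hx).1)
        rw [hSfin.mem_toFinset] at hZ
        let Z' : TopologicalSpace.IrreducibleCloseds (PSpace K r) := ⟨Z, hSirr Z hZ, hScl Z hZ⟩
        have hlt : l.last < Z' := by
          refine lt_of_le_not_ge hlZ fun hle => ?_
          exact (hlast (hle (hp ⟨Z, hZ⟩))).2 (by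
            change eval _ f ≠ 0
            rw [hfφ]
            exact hφ ⟨Z, hZ⟩)
        have hlast' : (l.snoc Z' hlt).last = Z' := RelSeries.last_snoc _ _ _
        refine hdim.not_ge ((natCast_le_dim_iff hY).2 ⟨l.snoc Z' hlt, ?_, ?_⟩)
        · rw [← hlm]
          rfl
        · rw [hlast']
          exact Set.subset_sUnion_of_mem hZ)
    refine ⟨Fin.cons f l, fun j => ?_, fun q hq => ?_⟩
    · refine Fin.cases ?_ (fun j => ?_) j
      · exact hf
      · exact hl j
    · by_cases hqf : eval q.rep f = 0
      · obtain ⟨j, hj⟩ := hlne q ⟨hq, fun h => h hqf⟩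
        exact ⟨j.succ, hj⟩
      · exact ⟨0, hqf⟩

theorem zclosure_cone_of_isClosed {Y : Set (PSpace K r)} (hY : IsClosed Y) :
    zclosure (cone Y) ⊆ cone Y := by
  have := zclosure_cone_subset Y
  rwa [hY.closure_eq] at this

theorem hasGrowth_cone [IsAlgClosed K] {Y : Set (PSpace K r)} (hY : IsClosed Y) {n : ℕ}
    (hdim : dim Y = (n : WithBot ℕ∞)) : HasGrowth (cone Y) (n + 1) := by
  obtain ⟨l, hl, hne⟩ := exists_linear_of_dim_lt (n + 1) hY (by
    rw [hdim]; exact_mod_cast Nat.lt_succ_self n)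
  refine hasGrowth_of_inter (zclosure_cone_of_isClosed hY) (isCone_cone Y) l hl fun v hv h => ?_
  by_contra hv0
  obtain ⟨j, hj⟩ := hne _ (hv hv0)
  exact hj ((eval_eq_zero_iff_rep (hl j) hv0).1 (h j))

/-- Every strict step of a chain of irreducible closed sets costs one exponent by `HasGrowth.drop`;
the passage from the smallest cone to its vertex costs the additional one. -/
theorem succ_le_of_hasGrowth [Infinite K] {Y : Set (PSpace K r)} (hY : IsClosed Y) {D s : ℕ}
    (hdim : (D : WithBot ℕ∞) ≤ dim Y) (hg : HasGrowth (cone Y) s) : D + 1 ≤ s := by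
  obtain ⟨l, rfl, hl⟩ := (natCast_le_dim_iff hY).1 hdim
  have key : ∀ (i : ℕ) (hi : i < l.length + 1) (s : ℕ),
      HasGrowth (cone (l ⟨i, hi⟩ : Set (PSpace K r))) s → i + 1 ≤ s := by
    intro i
    induction i with
    | zero =>
      intro hi s hs
      obtain ⟨p, hp⟩ := (l ⟨0, hi⟩).isIrreducible.1
      obtain ⟨i, hi⟩ := Function.ne_iff.1 p.rep_nonzero
      obtain ⟨s', rfl, -⟩ := hs.drop (T := {0}) (f := X i) (polyIrred_cone (l _).isIrreducible)
        (Set.singleton_nonempty _) (Set.singleton_subset_iff.2 (zero_mem_cone _)) (by simp)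
        ⟨p.rep, rep_mem_cone.2 hp, by simpa using hi⟩
      omega
    | succ i ih =>
      intro hi s hs
      have hlt : l ⟨i, by omega⟩ < l ⟨i + 1, hi⟩ := l.strictMono (by simp)
      obtain ⟨p, hp, hpn⟩ := Set.not_subset.1 hlt.not_ge
      have hpc : p.rep ∉ zclosure (cone (l ⟨i, by omega⟩ : Set (PSpace K r))) := fun h =>
        hpn (rep_mem_cone.1 (zclosure_cone_of_isClosed (l _).isClosed h))
      simp only [zclosure, Set.mem_ofPred_eq, not_forall] at hpc
      obtain ⟨f, hf, hfp⟩ := hpc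
      obtain ⟨s', rfl, hs'⟩ := hs.drop (polyIrred_cone (l _).isIrreducible)
        ⟨0, zero_mem_cone _⟩ (cone_mono hlt.le) hf ⟨p.rep, rep_mem_cone.2 hp, hfp⟩
      have := ih (by omega) s' hs'
      omega
  exact key l.length (Nat.lt_succ_self _) s (hg.mono ((cone_mono hl).trans (subset_zclosure _)))

end PSpace

/-! ### Secant varieties, joins and minimal decompositions -/

namespace PSpace

variable {K : Type*} [Field K] {r : ℕ}

theorem xRank_le {X : Set (PSpace K r)} {q : PSpace K r} {A : Finset (PSpace K r)}
    (hA : (A : Set (PSpace K r)) ⊆ X)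
    (hq : q ∈ Projectivization.Subspace.span (A : Set (PSpace K r))) : xRank X q ≤ A.card :=
  Nat.sInf_le ⟨A, hA, rfl, hq⟩

theorem mem_secantVariety {X : Set (PSpace K r)} {q : PSpace K r} {A : Finset (PSpace K r)}
    {k : ℕ} (hA : (A : Set (PSpace K r)) ⊆ X) (hk : A.card ≤ k)
    (hq : q ∈ Projectivization.Subspace.span (A : Set (PSpace K r))) : q ∈ secantVariety k X :=
  subset_closure ⟨A, hA, hk, hq⟩

theorem exists_card_eq_xRank {X : Set (PSpace K r)} {q : PSpace K r} {A : Finset (PSpace K r)}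
    (hA : (A : Set (PSpace K r)) ⊆ X)
    (hq : q ∈ Projectivization.Subspace.span (A : Set (PSpace K r))) :
    ∃ B : Finset (PSpace K r), (B : Set (PSpace K r)) ⊆ X ∧ B.card = xRank X q ∧
      q ∈ Projectivization.Subspace.span (B : Set (PSpace K r)) :=
  Nat.sInf_mem (s := {m | ∃ A : Finset (PSpace K r), (A : Set (PSpace K r)) ⊆ X ∧ A.card = m ∧
    q ∈ Projectivization.Subspace.span (A : Set (PSpace K r))}) ⟨_, A, hA, rfl, hq⟩

theorem xRank_eq_succ {X : Set (PSpace K r)} {q : PSpace K r} {k : ℕ}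
    (hq : q.rep ∈ (k + 1) • cone X) (hqk : q ∉ secantVariety k X) : xRank X q = k + 1 := by
  obtain ⟨A, hAX, hAk, hqA⟩ := mem_nsmul_cone_iff.1 hq
  rw [← mem_span_iff_rep] at hqA
  obtain ⟨B, hBX, hBc, hqB⟩ := exists_card_eq_xRank hAX hqA
  have h1 := xRank_le hAX hqA
  have h2 : ¬ B.card ≤ k := fun h => hqk (mem_secantVariety hBX h hqB)
  omega

theorem polyIrred_cone_secantVariety [Infinite K] {X : Set (PSpace K r)} (hX : IsIrreducible X)
    (k : ℕ) : PolyIrred (cone (secantVariety k X)) := by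
  rw [cone_secantVariety]
  exact ((polyIrred_cone hX).nsmul k).zclosure

theorem hasGrowth_cone_secantVariety [IsAlgClosed K] {X : Set (PSpace K r)} (hX : IsClosed X)
    {n : ℕ} (hdim : dim X = (n : WithBot ℕ∞)) (k : ℕ) :
    HasGrowth (cone (secantVariety k X)) (k * (n + 1)) := by
  rw [cone_secantVariety]
  exact ((hasGrowth_cone hX hdim).nsmul k).mono fun v hv => hv

/-- A nonempty open subset of the secant variety consists of points on spans of `k` points. -/
theorem exists_isOpen_rep_mem_nsmul_cone [IsAlgClosed K] {X : Set (PSpace K r)}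
    (hX_closed : IsClosed X) (hX : IsIrreducible X) {k : ℕ} (hne : (secantVariety k X).Nonempty) :
    ∃ U : Set (PSpace K r), IsOpen U ∧ (secantVariety k X ∩ U).Nonempty ∧
      ∀ q ∈ secantVariety k X ∩ U, q.rep ∈ k • cone X := by
  have hirr := (polyIrred_cone hX).nsmul k
  obtain ⟨D, hD⟩ := exists_constructible_nsmul (zclosure_cone_of_isClosed hX_closed) k
  obtain ⟨f, ⟨s, hs, hfs⟩, hf⟩ := exists_nonvanishing_subset hirr hD
  obtain ⟨q, hq⟩ := hne
  -- `f` need not be homogeneous, so the open set is given by one of its components. Where that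
  -- component is nonzero, `f` is nonzero at some nonzero multiple of the representative, and `k •
  -- cone X` is stable under scaling.
  obtain ⟨i, p, hp, hpi⟩ : ∃ i, ∃ p ∈ secantVariety k X,
      eval p.rep (homogeneousComponent i f) ≠ 0 := by
    by_contra! hcon
    have hzero : ∀ p ∈ secantVariety k X, ∀ c : K, eval (c • p.rep) f = 0 := fun p hp c => by
      rw [eval_smul_eq_sum]
      exact Finset.sum_eq_zero fun i _ => by rw [hcon i p hp, mul_zero]
    have hs' : s ∈ cone (secantVariety k X) := by
      rw [cone_secantVariety]
      exact subset_zclosure _ hs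
    by_cases hs0 : s = 0
    · have := hzero q hq 0
      rw [zero_smul] at this
      exact hfs (by rw [hs0, this])
    · obtain ⟨c, -, hc⟩ := exists_eq_smul_rep s hs0
      rw [hc] at hfs
      exact hfs (hzero _ (hs' hs0) c)
  refine ⟨_, isOpen_eval_ne_zero (homogeneousComponent_isHomogeneous i f), ⟨p, hp, hpi⟩, ?_⟩
  rintro x ⟨hx, hxi⟩
  obtain ⟨P, hP, hPc⟩ := exists_scalar_poly f x.rep
  have hP0 : P * Polynomial.X ≠ 0 := mul_ne_zero
    (fun h => hxi (by rw [← hPc, h, Polynomial.coeff_zero])) Polynomial.X_ne_zero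
  obtain ⟨c, hc⟩ : ∃ c, (P * Polynomial.X).eval c ≠ 0 := by
    by_contra! hcon
    exact hP0 (Polynomial.funext fun c => by rw [hcon c, Polynomial.eval_zero])
  rw [Polynomial.eval_mul, Polynomial.eval_X, hP] at hc
  have hc0 := right_ne_zero_of_mul hc
  have hx' : x.rep ∈ cone (secantVariety k X) := rep_mem_cone.2 hx
  have h1 : c • x.rep ∈ k • cone X := hf _ (by
    rw [← cone_secantVariety]
    exact isCone_cone _ c hc0 _ hx') (left_ne_zero_of_mul hc)
  have h2 := IsCone.nsmul (isCone_cone X) k c⁻¹ (inv_ne_zero hc0) _ h1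
  rwa [inv_smul_smul₀ hc0] at h2

/-- The points on the lines joining a point of `X` and a point of `Z`. -/
def joinSet (X Z : Set (PSpace K r)) : Set (PSpace K r) := {q | q.rep ∈ cone X + cone Z}

theorem hasGrowth_cone_closure_joinSet [Infinite K] {X Z : Set (PSpace K r)} {s t : ℕ}
    (hX : HasGrowth (cone X) s) (hZ : HasGrowth (cone Z) t) :
    HasGrowth (cone (closure (joinSet X Z))) (s + t) := by
  have hcone : IsCone (cone X + cone Z) := by
    rintro c hc _ ⟨v, hv, w, hw, rfl⟩
    rw [smul_add]
    exact Set.add_mem_add (isCone_cone X c hc v hv) (isCone_cone Z c hc w hw)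
  rw [cone_closure, joinSet,
    cone_rep_mem hcone ⟨0, zero_mem_cone X, 0, zero_mem_cone Z, add_zero 0⟩]
  exact (hX.add hZ).mono fun v hv => hv

theorem mem_span_insert_of_eq_add [DecidableEq (PSpace K r)] {B : Finset (PSpace K r)}
    {q a : PSpace K r} {v : Fin (r + 1) → K} (hv0 : v ≠ 0) {c : K} (hq : q.rep = c • a.rep + v)
    (hB : Projectivization.mk K v hv0 ∈ Projectivization.Subspace.span (B : Set (PSpace K r))) :
    q ∈ Projectivization.Subspace.span ((insert a B : Finset (PSpace K r)) : Set (PSpace K r)) := by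
  rw [mem_span_iff_rep] at hB ⊢
  obtain ⟨d, -, hd⟩ := exists_eq_smul_rep v hv0
  rw [Finset.coe_insert, Set.image_insert_eq, hq, Submodule.mem_span_insert]
  refine ⟨c, v, ?_, rfl⟩
  have h := Submodule.smul_mem _ d hB
  rwa [← hd] at h

/-- The family is the image of the minimal decompositions of `q'` under `insert a`. Everything
follows from `q` having rank exactly `k + 1`: a decomposition of `q'` that is too small, or of size
`k` and containing `a`, would give one of `q` with at most `k` points. -/
theorem exists_decomps_of_general {X : Set (PSpace K r)} {k : ℕ} {m : ℕ∞} (hk : 1 ≤ k)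
    {U : Set (PSpace K r)}
    (hU : ∀ q ∈ secantVariety k X ∩ U, (minDecomps X q).encard = m) {q : PSpace K r}
    (hqk : q ∉ secantVariety k X) (hrank : xRank X q = k + 1)
    (hqJ : q ∉ joinSet X (secantVariety k X ∩ Uᶜ))
    {A : Finset (PSpace K r)} (hA : A ∈ minDecomps X q) {a : PSpace K r} (ha : a ∈ A) :
    ∃ 𝓑 : Set (Finset (PSpace K r)), 𝓑 ⊆ minDecomps X q ∧ A ∈ 𝓑 ∧ (∀ B ∈ 𝓑, a ∈ B) ∧
      𝓑.encard = m := by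
  classical
  obtain ⟨hAX, hAc, hqA⟩ := hA
  have haX : a ∈ X := hAX ha
  have hcard : (A.erase a).card = k := by rw [Finset.card_erase_of_mem ha, hAc, hrank]; rfl
  have hEX : ((A.erase a : Finset (PSpace K r)) : Set (PSpace K r)) ⊆ X :=
    fun x hx => hAX (Finset.mem_of_mem_erase hx)
  obtain ⟨c, v, hv, hqv⟩ : ∃ (c : K) (v : Fin (r + 1) → K), v ∈ Submodule.span K
      (Projectivization.rep '' ((A.erase a : Finset (PSpace K r)) : Set (PSpace K r))) ∧
      q.rep = c • a.rep + v := by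
    rw [mem_span_iff_rep, ← Finset.insert_erase ha, Finset.coe_insert, Set.image_insert_eq,
      Submodule.mem_span_insert] at hqA
    exact hqA
  -- Otherwise `q` is the point `a` itself, which lies in σ_k because `1 ≤ k`.
  have hv0 : v ≠ 0 := by
    rintro rfl
    refine hqk (mem_secantVariety (A := {a}) (by simpa using haX) (by simpa using hk) ?_)
    rw [mem_span_iff_rep, hqv, add_zero]
    exact Submodule.smul_mem _ _ (Submodule.subset_span ⟨a, by simp, rfl⟩)
  set q' := Projectivization.mk K v hv0 with hq'
  obtain ⟨d, hd0, hd⟩ := exists_eq_smul_rep v hv0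
  have hq'A : q' ∈ Projectivization.Subspace.span
      ((A.erase a : Finset (PSpace K r)) : Set (PSpace K r)) := by
    rw [mem_span_iff_rep]
    have h := Submodule.smul_mem _ d⁻¹ hv
    have h2 : d⁻¹ • v = q'.rep := by
      conv_lhs => rw [hd]
      exact inv_smul_smul₀ hd0 _
    rwa [h2] at h
  have hq'k : q' ∈ secantVariety k X := mem_secantVariety hEX hcard.le hq'A
  have hq'U : q' ∈ U := by
    by_contra h
    refine hqJ ?_
    change q.rep ∈ cone X + cone (secantVariety k X ∩ Uᶜ)
    rw [hqv]
    exact Set.add_mem_add (smul_rep_mem_cone haX c) fun _ => ⟨hq'k, h⟩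
  have hins : ∀ B : Finset (PSpace K r), q' ∈ Projectivization.Subspace.span (B : Set _) →
      q ∈ Projectivization.Subspace.span ((insert a B : Finset (PSpace K r)) : Set (PSpace K r)) :=
    fun B hB => mem_span_insert_of_eq_add hv0 hqv hB
  have hinsX : ∀ B : Finset (PSpace K r), (B : Set (PSpace K r)) ⊆ X →
      ((insert a B : Finset (PSpace K r)) : Set (PSpace K r)) ⊆ X := fun B hB => by
    rw [Finset.coe_insert]
    exact Set.insert_subset haX hB
  have hrank' : xRank X q' = k := by
    refine le_antisymm ((xRank_le hEX hq'A).trans hcard.le) ?_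
    obtain ⟨B, hBX, hBc, hB⟩ := exists_card_eq_xRank hEX hq'A
    have h1 := xRank_le (hinsX B hBX) (hins B hB)
    have h2 := Finset.card_insert_le a B
    omega
  have hnot : ∀ B ∈ minDecomps X q', a ∉ B := by
    rintro B ⟨hBX, hBc, hB⟩ haB
    have h1 := xRank_le (hinsX B hBX) (hins B hB)
    rw [Finset.insert_eq_self.2 haB] at h1
    omega
  refine ⟨(insert a) '' minDecomps X q', ?_, ?_, ?_, ?_⟩
  · rintro _ ⟨B, hB, rfl⟩
    refine ⟨hinsX B hB.1, ?_, hins B hB.2.2⟩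
    rw [Finset.card_insert_of_notMem (hnot B hB), hB.2.1, hrank, hrank']
  · exact ⟨A.erase a, ⟨hEX, by rw [hcard, hrank'], hq'A⟩, Finset.insert_erase ha⟩
  · rintro _ ⟨B, _, rfl⟩
    exact Finset.mem_insert_self _ _
  · rw [Set.InjOn.encard_image, hU q' ⟨hq'k, hq'U⟩]
    intro B hB B' hB' h
    have h1 := congrArg (fun C : Finset (PSpace K r) => C.erase a) h
    simpa [Finset.erase_insert (hnot B hB), Finset.erase_insert (hnot B' hB')] using h1

theorem exists_mem_compl_of_hasGrowth [Infinite K] {Y Z : Set (PSpace K r)} (hY : IsClosed Y)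
    {D s : ℕ} (hdim : dim Y = (D : WithBot ℕ∞)) (hZ : HasGrowth (cone Z) s) (hs : s ≤ D) :
    (Y ∩ Zᶜ).Nonempty := by
  by_contra hcon
  have hYZ : Y ⊆ Z := fun x hx => by
    by_contra h
    exact hcon ⟨x, hx, h⟩
  have := succ_le_of_hasGrowth hY hdim.ge (hZ.mono ((cone_mono hYZ).trans (subset_zclosure _)))
  omega

end PSpace

open PSpace in
theorem mainTheorem10 {K : Type*} [Field K] [IsAlgClosed K] (r n k : ℕ) (hk : 1 ≤ k)
    (X : Set (PSpace K r)) (hX_closed : IsClosed X) (hX_irred : IsIrreducible X)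
    (hX_nondeg : Projectivization.Subspace.span X = ⊤)
    (hX_dim : PSpace.dim X = (n : WithBot ℕ∞))
    (hσ : PSpace.dim (PSpace.secantVariety (k + 1) X) =
      (((k + 1) * (n + 1) - 1 : ℕ) : WithBot ℕ∞))
    (hα : 1 < PSpace.secantDegree k X) :
    PSpace.ForGeneral (PSpace.secantVariety (k + 1) X) (fun q =>
      ∀ A ∈ PSpace.minDecomps X q, ∀ a ∈ A,
        ∃ 𝓑 : Set (Finset (PSpace K r)),
          𝓑 ⊆ PSpace.minDecomps X q ∧ A ∈ 𝓑 ∧ (∀ B ∈ 𝓑, a ∈ B) ∧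
            𝓑.encard = PSpace.secantDegree k X) := by
  obtain ⟨U, hUo, ⟨u, huk, huU⟩, hU⟩ : ForGeneral (secantVariety k X)
      (fun q => (minDecomps X q).encard = secantDegree k X) := by
    by_cases h : ∃ m : ℕ∞, ForGeneral (secantVariety k X) (fun q => (minDecomps X q).encard = m)
    · rw [secantDegree, dif_pos h]
      exact h.choose_spec
    -- The default value `0` is excluded by `1 < secantDegree k X`, so a generic number exists.
    · rw [secantDegree, dif_neg h] at hα
      simp at hα
  have hσc : ∀ j, IsClosed (secantVariety j X) := fun j => isClosed_closure
  set Z := secantVariety k X ∩ Uᶜ with hZ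
  have hZc : IsClosed Z := (hσc k).inter hUo.isClosed_compl
  have hgk := hasGrowth_cone_secantVariety hX_closed hX_dim k
  have huZ : u.rep ∉ zclosure (cone Z) := fun h =>
    (rep_mem_cone.1 (zclosure_cone_of_isClosed hZc h)).2 huU
  simp only [zclosure, Set.mem_ofPred_eq, not_forall] at huZ
  obtain ⟨f, hfZ, hfu⟩ := huZ
  -- `Z` misses `u`, so the exponent falls to `t` with `t + 1 = k * (n + 1)`.
  obtain ⟨t, ht, hgZ⟩ := hgk.drop (polyIrred_cone_secantVariety hX_irred k) ⟨0, zero_mem_cone Z⟩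
    (cone_mono Set.inter_subset_left) hfZ ⟨u.rep, rep_mem_cone.2 huk, hfu⟩
  have hgJ := hasGrowth_cone_closure_joinSet (hasGrowth_cone hX_closed hX_dim) hgZ
  have harith : (k + 1) * (n + 1) = k * (n + 1) + (n + 1) := by ring
  -- Both exponents, `k * (n + 1)` for σ_k and `(n + 1) + t` for the join, are at most the dimension
  -- `(k + 1) * (n + 1) - 1` of σ_{k+1}, so neither set contains it.
  have hne1 := exists_mem_compl_of_hasGrowth (hσc (k + 1)) hσ hgk (by omega)
  have hne2 := exists_mem_compl_of_hasGrowth (hσc (k + 1)) hσ hgJ (by omega)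
  obtain ⟨V, hV, hVne, hVmem⟩ := exists_isOpen_rep_mem_nsmul_cone hX_closed hX_irred
    (hne1.mono Set.inter_subset_left)
  have hirr : IsIrreducible (secantVariety (k + 1) X) := isIrreducible_of_polyIrred
    (hne1.mono Set.inter_subset_left) (polyIrred_cone_secantVariety hX_irred (k + 1))
  have hne3 := hirr.2 _ _ (hσc k).isOpen_compl isClosed_closure.isOpen_compl hne1 hne2
  have hne4 := hirr.2 _ _ ((hσc k).isOpen_compl.inter
    (isClosed_closure (s := joinSet X Z)).isOpen_compl) hV hne3 hVne
  refine ⟨_, ((hσc k).isOpen_compl.inter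
    (isClosed_closure (s := joinSet X Z)).isOpen_compl).inter hV, hne4, ?_⟩
  rintro q ⟨hq, ⟨hqk, hqJ⟩, hqV⟩ A hA a ha
  exact exists_decomps_of_general hk hU hqk (xRank_eq_succ (hVmem q ⟨hq, hqV⟩) hqk)
    (fun h => hqJ (subset_closure h)) hA ha
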